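/- Let $p>2$ and $N>0$. There is a constant $\gamma>0$, depending only on $p$ and $N$, such that the following holds. Let $G$ be a simple, undirected, connected, infinite graph with vertex set $V$ and a symmetric weight $\omega:V\times V\to[0,\infty)$ with $\omega(x,y)>0$ if and only if $x\sim y$ (adjacent vertices), such that $d_\omega(x)=\sum_{y\sim x}\omega(x,y)<\infty$ for all $x\in V$ (for instance, $G$ locally finite). Put $$\|f\|_{\ell^q(V)}^q=\sum_{x\in V}|f(x)|^q d_\omega(x)\ (q\ge 1),\qquad \|f\|_{\ell^\infty(V)}=\sup_{x\in V}|f(x)|,\qquad \mu_\omega(U)=\sum_{x\in U}d_\omega(x),$$ $$D_yf(x)=f(y)-f(x),\qquad \Delta_pf(x)=\frac1{d_\omega(x)}\sum_{y\in V}|f(y)-f(x)|^{p-2}(f(y)-f(x))\,\omega(x,y).$$ Let $\Lambda_p:(0,\infty)\to(0,\infty)$ be continuous and decreasing, such that $v\mapsto\Lambda_p(v)^{-1}v^{-p/N}$ is nondecreasing and, for some constant $\kappa>0$, $v\mapsto\Lambda_p(v)^{-1}v^{-\kappa}$ is nonincreasing on $(0,\infty)$. Assume that $G$ satisfies the global Faber–Krahn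 inequality: for all $v>0$, all finite $U\subset V$ with $\mu_\omega(U)=v$, and all $f:V\to\mathbb R$ vanishing outside $U$, $$\Lambda_p(v)\sum_{x\in U}|f(x)|^pd_\omega(x)\le\sum_{x,y\in (U)_1}|f(y)-f(x)|^p\,\omega(x,y),$$ where $(U)_1$ is the set of vertices at graph distance at most $1$ from $U$. Let $\psi_1(s)=s^{p-2}\Lambda_p(s^{-1})$, $s>0$, an increasing bijection of $(0,\infty)$ with inverse $\psi_1^{(-1)}$. For $0<T<\infty$ and $r\ge1$, a solution on $[0,T]$ of class $L^\infty(0,T;\ell^r(V))$ of the Cauchy problem $$\frac{\partial u}{\partial t}=\Delta_pu,\qquad u(x,0)=u_0(x),$$ is a function $u\in L^\infty(0,T;\ell^r(V))$ with $u(x,\cdot)\in C^1([0,T])$ for every $x\in V$, satisfying the equation pointwise for $x\in V$, $0<t<T$, and the initial condition for every $x\in V$. Let $u_0\in\ell^1(V)$, $u_0\ge0$. Then there is a function $u\ge0$ on $V\times[0,\infty)$ which is a solution of class $L^\infty(0,T;\ell^1(V))$ on $[0,T]$ for every $T>0$. It is unique: for every $T>0$ and $r\ge1$, any solution on $[0,T]$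 of class $L^\infty(0,T;\ell^r(V))$ with the same initial datum coincides with $u$ on $V\times[0,T]$. Moreover, for all $t>0$, $$\|u(t)\|_{\ell^1(V)}=\|u_0\|_{\ell^1(V)},$$ $$\|u(t)\|_{\ell^\infty(V)}\le\gamma\,\|u_0\|_{\ell^1(V)}\,\psi_1^{(-1)}\big(t^{-1}\|u_0\|_{\ell^1(V)}^{-(p-2)}\big),$$ $$\int_0^t\sum_{x,y\in V}|D_yu(x,\tau)|^{p-1}\omega(x,y)\,d\tau\le\gamma\,t^{1/p}\,\|u_0\|_{\ell^1(V)}^{2(p-1)/p}\,\psi_1^{(-1)}\big(t^{-1}\|u_0\|_{\ell^1(V)}^{-(p-2)}\big)^{(p-2)/p},$$ where the right-hand sides of the last two estimates are read as $0$ if $u_0=0$. -/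

import Mathlib

open MeasureTheory Set
open scoped ENNReal NNReal

/-- A simple, undirected, connected weighted graph with vertex set `V`.  The weight is symmetric,
nonnegative, strictly positive exactly on the edges, and has finite weighted degrees
(every locally finite graph qualifies). -/
structure WeightedGraph (V : Type*) where
  graph : SimpleGraph V
  weight : V → V → ℝ
  weight_symm : ∀ x y, weight x y = weight y x
  weight_nonneg : ∀ x y, 0 ≤ weight x y
  weight_pos_iff : ∀ x y, 0 < weight x y ↔ graph.Adj x y
  connected : graph.Connected
  summable_weight : ∀ x, Summable (weight x)

/-- The `ℓ^∞(V)` norm, which is `∞` for unbounded `f`. -/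
noncomputable def lInfNorm {V : Type*} (f : V → ℝ) : ℝ≥0∞ := ⨆ x, ENNReal.ofReal |f x|

namespace WeightedGraph

variable {V : Type*} (G : WeightedGraph V)

/-- The weighted degree `d_ω(x) = ∑_{y ∼ x} ω(x, y)`; the other terms vanish. -/
noncomputable def deg (x : V) : ℝ := ∑' y, G.weight x y

/-- The measure `μ_ω(U) = ∑_{x ∈ U} d_ω(x)` of a finite set of vertices. -/
noncomputable def vol (U : Finset V) : ℝ := ∑ x ∈ U, G.deg x

/-- The discrete `p`-Laplacian. -/
noncomputable def pLaplacian (p : ℝ) (f : V → ℝ) (x : V) : ℝ :=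
  (1 / G.deg x) * ∑' y, |f y - f x| ^ (p - 2) * (f y - f x) * G.weight x y

/-- The norm of `ℓ^q(V)` with the weight `d_ω`; its value is `∞` exactly when `f ∉ ℓ^q(V)`. -/
noncomputable def lNorm (q : ℝ) (f : V → ℝ) : ℝ≥0∞ :=
  (∑' x, ENNReal.ofReal (|f x| ^ q * G.deg x)) ^ (1 / q)

/-- The set `(U)_1` of the vertices at combinatorial distance at most `1` from `U`. -/
def nbhd (U : Finset V) : Set V := {x | ∃ y ∈ U, G.graph.dist x y ≤ 1}

/-- The global Faber–Krahn inequality for the exponent `p` and the function `Λ`. -/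
def FaberKrahn (p : ℝ) (Λ : ℝ → ℝ) : Prop :=
  ∀ v : ℝ, 0 < v → ∀ U : Finset V, G.vol U = v →
    ∀ f : V → ℝ, (∀ x, x ∉ U → f x = 0) →
      Λ v * ∑ x ∈ U, |f x| ^ p * G.deg x ≤
        ∑' z : (G.nbhd U ×ˢ G.nbhd U : Set (V × V)),
          |f z.1.2 - f z.1.1| ^ p * G.weight z.1.1 z.1.2

/-- `u` is a solution of `∂u/∂t = Δ_p u` on `V × (0, T)` of class `L^∞(0, T; ℓ^r(V))`.
Since `V` is countable and each `u x` is continuous, measurability in `t` is automatic. -/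
structure IsSolution (p r T : ℝ) (u : V → ℝ → ℝ) : Prop where
  bounded : ∃ C : ℝ≥0, ∀ᵐ t ∂(volume.restrict (Ioo 0 T)), G.lNorm r (fun x => u x t) ≤ C
  contDiff : ∀ x, ContDiffOn ℝ 1 (u x) (Icc 0 T)
  equation : ∀ x, ∀ t ∈ Ioo 0 T, HasDerivAt (u x) (G.pLaplacian p (fun y => u y t) x) t

/-- A solution of the Cauchy problem on `V × (0, T)` with initial datum `u₀`. -/
structure IsCauchySolution (p r T : ℝ) (u₀ : V → ℝ) (u : V → ℝ → ℝ) : Prop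
    extends G.IsSolution p r T u where
  initial : ∀ x, u x 0 = u₀ x

end WeightedGraph

/-- The structural assumptions on the Faber–Krahn function `Λ : (0,∞) → (0,∞)`; values of `Λ`
outside `(0,∞)` are irrelevant. -/
structure FaberKrahnFunction (p N ω : ℝ) (Λ : ℝ → ℝ) : Prop where
  pos : ∀ v, 0 < v → 0 < Λ v
  continuousOn : ContinuousOn Λ (Ioi 0)
  antitoneOn : AntitoneOn Λ (Ioi 0)
  lower_growth : MonotoneOn (fun v => (Λ v)⁻¹ * v ^ (-(p / N))) (Ioi 0)
  upper_growth : AntitoneOn (fun v => (Λ v)⁻¹ * v ^ (-ω)) (Ioi 0)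

/-- The function `ψ_r(s) = s^((p-2)/r) Λ(1/s)`, for `s > 0`. -/
noncomputable def psi (p r : ℝ) (Λ : ℝ → ℝ) (s : ℝ) : ℝ := s ^ ((p - 2) / r) * Λ s⁻¹

/-- The inverse function of `ψ_r : (0,∞) → (0,∞)`. -/
noncomputable def psiInv (p r : ℝ) (Λ : ℝ → ℝ) : ℝ → ℝ :=
  Function.invFunOn (psi p r Λ) (Ioi 0)

/-- `ψ_r` is a bijection of `(0,∞)`, so that `psiInv` is its genuine inverse there. -/
theorem psi_bijOn {p r N ω : ℝ} {Λ : ℝ → ℝ} (hp : 2 < p) (hr : 1 ≤ r) (hN : 0 < N)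
    (h : FaberKrahnFunction p N ω Λ) : BijOn (psi p r Λ) (Ioi 0) (Ioi 0) := by
  have ha : 0 < (p - 2) / r := div_pos (by linarith) (by linarith)
  have hb : 0 < p / N := div_pos (by linarith) hN
  have hmap : MapsTo (psi p r Λ) (Ioi 0) (Ioi 0) := fun s hs =>
    mul_pos (Real.rpow_pos_of_pos hs _) (h.pos _ (inv_pos.2 hs))
  have hmono : StrictMonoOn (psi p r Λ) (Ioi 0) := by
    intro s hs t ht hst
    have h1 : s ^ ((p - 2) / r) < t ^ ((p - 2) / r) :=
      Real.rpow_lt_rpow (le_of_lt hs) hst ha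
    have h2 : Λ s⁻¹ ≤ Λ t⁻¹ :=
      h.antitoneOn (inv_pos.2 ht : 0 < t⁻¹) (inv_pos.2 hs : 0 < s⁻¹)
        (inv_anti₀ hs hst.le)
    exact mul_lt_mul h1 h2 (h.pos _ (inv_pos.2 hs)) (Real.rpow_nonneg (le_of_lt ht) _)
  have hcont : ContinuousOn (psi p r Λ) (Ioi 0) := by
    refine ContinuousOn.mul ?_ ?_
    · exact continuousOn_id.rpow_const fun x hx => Or.inl (ne_of_gt hx)
    · refine h.continuousOn.comp (continuousOn_inv₀.mono fun x hx => ne_of_gt hx) ?_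
      exact fun x hx => inv_pos.2 (show (0 : ℝ) < x from hx)
  -- a comparison of `psi` with powers on both sides of `s = 1`
  have hL : 0 < Λ 1 := h.pos 1 one_pos
  have hlow : ∀ s : ℝ, 1 ≤ s → s ^ ((p - 2) / r) * Λ 1 ≤ psi p r Λ s := fun s hs =>
    mul_le_mul_of_nonneg_left
      (h.antitoneOn (inv_pos.2 (by linarith) : 0 < s⁻¹) (one_pos : (0 : ℝ) < 1)
        (inv_le_one_of_one_le₀ hs))
      (Real.rpow_nonneg (by linarith) _)
  have hupp : ∀ s : ℝ, 0 < s → s ≤ 1 → psi p r Λ s ≤ s ^ ((p - 2) / r) * Λ 1 := fun s h0 hs =>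
    mul_le_mul_of_nonneg_left
      (h.antitoneOn (one_pos : (0 : ℝ) < 1) (inv_pos.2 h0 : 0 < s⁻¹)
        ((one_le_inv₀ h0).2 hs))
      (Real.rpow_nonneg h0.le _)
  refine ⟨hmap, hmono.injOn, ?_⟩
  intro y hy
  have hy0 : 0 < y := hy
  have hyL : 0 < y / Λ 1 := div_pos hy0 hL
  set c : ℝ := (y / Λ 1) ^ ((p - 2) / r)⁻¹ with hc
  have hc0 : 0 < c := Real.rpow_pos_of_pos hyL _
  have hcy : c ^ ((p - 2) / r) * Λ 1 = y := by
    rw [hc, Real.rpow_inv_rpow hyL.le ha.ne', div_mul_cancel₀ _ hL.ne']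
  have hm0 : 0 < min c 1 := lt_min hc0 one_pos
  have hM0 : 0 < max c 1 := lt_max_of_lt_left hc0
  have hsub : Icc (min c 1) (max c 1) ⊆ Ioi 0 := fun x hx => lt_of_lt_of_le hm0 hx.1
  have hlo : psi p r Λ (min c 1) ≤ y :=
    (hupp _ hm0 (min_le_right _ _)).trans <| hcy ▸
      mul_le_mul_of_nonneg_right (Real.rpow_le_rpow hm0.le (min_le_left _ _) ha.le) hL.le
  have hhi : y ≤ psi p r Λ (max c 1) :=
    le_trans (hcy ▸
      mul_le_mul_of_nonneg_right (Real.rpow_le_rpow hc0.le (le_max_left _ _) ha.le) hL.le)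
      (hlow _ (le_max_right _ _))
  obtain ⟨x, hx, hxy⟩ := intermediate_value_Icc (min_le_max : min c 1 ≤ max c 1)
    (hcont.mono hsub) ⟨hlo, hhi⟩
  exact ⟨x, hsub hx, hxy⟩

/-!
The Faber–Krahn inequality of one-point sets bounds the degrees below, so `ℓ^r(V) ⊆ ℓ^∞(V)` for
every `r ≥ 1`, and on bounded functions `Δ_p` is Lipschitz, both for the sup norm and in `ℓ¹(V)`.

* *Existence and uniqueness.*  With the flux truncated to bounded differences the equation is a
  Lipschitz ordinary differential equation in `ℓ¹(V)` (`WeightedGraph.exists_flow`).  A comparison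
  principle in the sup norm (`nonpos_of_deriv_le`) keeps the solution between `0` and the maximum
  of the datum, which makes the truncation void.  It also gives uniqueness.  Mass is conserved since
  the flux is antisymmetric.
* *A one-sided bound on the time derivative.*  Comparing `u(x, t)` with the solution
  `l^(1/(p-2)) u(x, l t)`, `l > 1`, yields `-Δ_p u ≤ u / ((p-2) t)`
  (`WeightedGraph.IsGlobalFlow.neg_pLaplacian_le`).  Hence both estimates reduce to elliptic ones
  at a fixed time, for functions with `-Δ_p f ≤ A f` (`WeightedGraph.IsSubEigen`).
* *Sup bound.*  De Giorgi's iteration on superlevel sets near the maximum `H`, with the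
  Faber–Krahn inequality in each step, gives `H^(p-2) Λ(2M/H) ≤ C(p, N) A`, where `M` is the mass
  (`WeightedGraph.IsSubEigen.max_estimate`).  For `A = 1/((p-2) t)` this is the bound by `ψ⁻¹`.
* *Gradient bound.*  Testing with `f^θ`, `θ = (p-2)/(p-1)`, bounds `∑ |D f|^(p-1) ω` at a fixed
  time (`WeightedGraph.IsSubEigen.tsum_abs_sub_rpow_le`).  The lower growth of `1/Λ` controls
  `ψ⁻¹` at earlier times by a power of `t/τ` (`psiInv_le_mul_psiInv`), and the resulting
  power of `τ` is integrable at `0`.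
-/

/-! ### The nonlinearity of the `p`-Laplacian -/

/-- The odd power `s ↦ |s|^(p-2) s`, the flux through an edge with difference `s`. -/
noncomputable def pFlux (p s : ℝ) : ℝ := |s| ^ (p - 2) * s

/-- The flux with its argument truncated to `[-K, K]`.  It agrees with `pFlux` on differences of
size at most `K`, and unlike `pFlux` it is bounded and globally Lipschitz. -/
noncomputable def truncFlux (p K s : ℝ) : ℝ := pFlux p (max (-K) (min K s))

theorem pFlux_zero (p : ℝ) : pFlux p 0 = 0 := by simp [pFlux]

theorem pFlux_neg (p s : ℝ) : pFlux p (-s) = -pFlux p s := by simp [pFlux]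

theorem pFlux_of_nonneg {p s : ℝ} (hp : 2 < p) (hs : 0 ≤ s) : pFlux p s = s ^ (p - 1) := by
  rcases hs.eq_or_lt with rfl | hs
  · rw [pFlux_zero, Real.zero_rpow (by linarith)]
  · rw [pFlux, abs_of_pos hs, show p - 1 = (p - 2) + 1 by ring, Real.rpow_add_one hs.ne']

theorem abs_pFlux {p : ℝ} (hp : 2 < p) (s : ℝ) : |pFlux p s| = |s| ^ (p - 1) := by
  rw [← pFlux_of_nonneg hp (abs_nonneg s), pFlux, pFlux, abs_mul, abs_abs,
    abs_of_nonneg (Real.rpow_nonneg (abs_nonneg s) _)]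

theorem pFlux_mul {p c : ℝ} (hp : 2 < p) (hc : 0 ≤ c) (s : ℝ) :
    pFlux p (c * s) = c ^ (p - 1) * pFlux p s := by
  rw [← pFlux_of_nonneg hp hc, pFlux, pFlux, pFlux, abs_mul, Real.mul_rpow (abs_nonneg _)
    (abs_nonneg _)]
  ring

theorem monotone_pFlux {p : ℝ} (hp : 2 < p) : Monotone (pFlux p) := by
  have hpos : ∀ s t : ℝ, 0 ≤ s → s ≤ t → pFlux p s ≤ pFlux p t := fun s t hs hst => by
    rw [pFlux_of_nonneg hp hs, pFlux_of_nonneg hp (hs.trans hst)]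
    exact Real.rpow_le_rpow hs hst (by linarith)
  intro s t hst
  rcases le_total 0 s with hs | hs
  · exact hpos s t hs hst
  rcases le_total 0 t with ht | ht
  · have h1 := hpos 0 t le_rfl ht
    have h2 := hpos 0 (-s) le_rfl (by linarith)
    rw [pFlux_zero] at h1 h2
    rw [pFlux_neg] at h2
    linarith
  · have := hpos (-t) (-s) (by linarith) (by linarith)
    rw [pFlux_neg, pFlux_neg] at this
    linarith

theorem pFlux_sub_le {p K s t : ℝ} (hp : 2 < p) (hs : -K ≤ s) (hst : s ≤ t) (ht : t ≤ K) :
    pFlux p t - pFlux p s ≤ (p - 1) * K ^ (p - 2) * (t - s) := by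
  have hpos : ∀ s t : ℝ, 0 ≤ s → s ≤ t → t ≤ K →
      pFlux p t - pFlux p s ≤ (p - 1) * K ^ (p - 2) * (t - s) := fun s t hs hst ht => by
    rw [pFlux_of_nonneg hp hs, pFlux_of_nonneg hp (hs.trans hst)]
    have hd : ∀ x : ℝ, HasDerivAt (fun x : ℝ => x ^ (p - 1)) ((p - 1) * x ^ (p - 1 - 1)) x :=
      fun x => Real.hasDerivAt_rpow_const (Or.inr (by linarith))
    refine (convex_Icc s t).image_sub_le_mul_sub_of_deriv_le
      (fun x _ => (hd x).continuousAt.continuousWithinAt)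
      (fun x _ => (hd x).differentiableAt.differentiableWithinAt) ?_
      s (left_mem_Icc.2 hst) t (right_mem_Icc.2 hst) hst
    intro x hx
    rw [interior_Icc] at hx
    rw [(hd x).deriv, show p - 1 - 1 = p - 2 by ring]
    exact mul_le_mul_of_nonneg_left (Real.rpow_le_rpow (hs.trans hx.1.le) (hx.2.le.trans ht)
      (by linarith)) (by linarith)
  rcases le_total 0 s with h0 | h0
  · exact hpos s t h0 hst ht
  rcases le_total 0 t with h1 | h1
  · have h2 := hpos 0 t le_rfl h1 ht
    have h3 := hpos 0 (-s) le_rfl (by linarith) (by linarith)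
    rw [pFlux_zero] at h2 h3
    rw [pFlux_neg] at h3
    linarith
  · have := hpos (-t) (-s) (by linarith) (by linarith) (by linarith)
    rw [pFlux_neg, pFlux_neg] at this
    linarith

theorem truncFlux_eq {p K s : ℝ} (hs : |s| ≤ K) : truncFlux p K s = pFlux p s := by
  rw [truncFlux, min_eq_right (abs_le.1 hs).2, max_eq_right (abs_le.1 hs).1]

theorem truncFlux_zero {p K : ℝ} (hK : 0 ≤ K) : truncFlux p K 0 = 0 := by
  rw [truncFlux_eq (by simpa using hK), pFlux_zero]

theorem truncFlux_neg {p K : ℝ} (hK : 0 ≤ K) (s : ℝ) :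
    truncFlux p K (-s) = -truncFlux p K s := by
  rw [truncFlux, truncFlux, ← pFlux_neg]
  congr 1
  rcases le_total K s with h | h
  · rw [min_eq_left h, min_eq_right (by linarith), max_eq_left (by linarith),
      max_eq_right (by linarith)]
  rcases le_total K (-s) with h' | h'
  · rw [min_eq_left h', min_eq_right h, max_eq_right (by linarith), max_eq_left (by linarith),
      neg_neg]
  · rw [min_eq_right h, min_eq_right h', max_eq_right (by linarith), max_eq_right (by linarith)]

theorem monotone_truncFlux {p : ℝ} (hp : 2 < p) (K : ℝ) : Monotone (truncFlux p K) :=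
  fun _ _ h => monotone_pFlux hp (max_le_max le_rfl (min_le_min le_rfl h))

theorem truncFlux_sub_le {p K s t : ℝ} (hp : 2 < p) (hK : 0 ≤ K) (hst : s ≤ t) :
    truncFlux p K t - truncFlux p K s ≤ (p - 1) * K ^ (p - 2) * (t - s) := by
  have hL : 0 ≤ (p - 1) * K ^ (p - 2) := mul_nonneg (by linarith) (Real.rpow_nonneg hK _)
  refine (pFlux_sub_le hp (le_max_left _ _) (max_le_max le_rfl (min_le_min le_rfl hst))
    (max_le (by linarith) (min_le_left _ _))).trans (mul_le_mul_of_nonneg_left ?_ hL)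
  rcases max_cases (-K) (min K t) with h1 | h1 <;> rcases max_cases (-K) (min K s) with h2 | h2 <;>
  rcases min_cases K t with h3 | h3 <;> rcases min_cases K s with h4 | h4 <;> linarith

theorem abs_truncFlux_sub_le {p K : ℝ} (hp : 2 < p) (hK : 0 ≤ K) (s t : ℝ) :
    |truncFlux p K t - truncFlux p K s| ≤ (p - 1) * K ^ (p - 2) * |t - s| := by
  rcases le_total s t with h | h
  · rw [abs_of_nonneg (sub_nonneg.2 (monotone_truncFlux hp K h)), abs_of_nonneg (by linarith)]
    exact truncFlux_sub_le hp hK h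
  · rw [abs_of_nonpos (sub_nonpos.2 (monotone_truncFlux hp K h)), abs_of_nonpos (by linarith),
      neg_sub, neg_sub]
    exact truncFlux_sub_le hp hK h

theorem abs_truncFlux_le_mul {p K : ℝ} (hp : 2 < p) (hK : 0 ≤ K) (s : ℝ) :
    |truncFlux p K s| ≤ (p - 1) * K ^ (p - 2) * |s| := by
  simpa [truncFlux_zero hK] using abs_truncFlux_sub_le hp hK 0 s

theorem abs_truncFlux_le {p K : ℝ} (hp : 2 < p) (hK : 0 ≤ K) (s : ℝ) :
    |truncFlux p K s| ≤ K ^ (p - 1) := by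
  rw [truncFlux, abs_pFlux hp]
  exact Real.rpow_le_rpow (abs_nonneg _)
    (abs_le.2 ⟨le_max_left _ _, max_le (by linarith) (min_le_left _ _)⟩) (by linarith)

/-! ### Sums over vertices and over pairs of vertices -/

/-- Summation by parts: an antisymmetric summable edge function `F`, tested with a bounded `g`. -/
theorem tsum_mul_tsum_eq_of_antisymm {V : Type*} {F : V × V → ℝ} (hF : Summable F)
    (hanti : ∀ x y, F (y, x) = -F (x, y)) {g : V → ℝ} {B : ℝ} (hg : ∀ x, |g x| ≤ B) :
    (Summable fun x => g x * ∑' y, F (x, y)) ∧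
    (Summable fun z : V × V => F z * (g z.2 - g z.1)) ∧
      ∑' x, g x * ∑' y, F (x, y) = -(1 / 2) * ∑' z : V × V, F z * (g z.2 - g z.1) := by
  have h1 : Summable fun z : V × V => g z.1 * F z := by
    refine Summable.of_norm_bounded (hF.abs.mul_left B) fun z => ?_
    rw [Real.norm_eq_abs, abs_mul]
    exact mul_le_mul_of_nonneg_right (hg _) (abs_nonneg _)
  have h2 : Summable fun z : V × V => g z.2 * F z := by
    refine Summable.of_norm_bounded (hF.abs.mul_left B) fun z => ?_
    rw [Real.norm_eq_abs, abs_mul]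
    exact mul_le_mul_of_nonneg_right (hg _) (abs_nonneg _)
  have h3 : ∑' z : V × V, g z.2 * F z = -∑' z : V × V, g z.1 * F z := by
    rw [← (Equiv.prodComm V V).tsum_eq, ← tsum_neg]
    refine tsum_congr fun z => ?_
    simp only [Equiv.prodComm_apply, Prod.swap, hanti z.1 z.2]
    ring
  have h4 : ∑' x, g x * ∑' y, F (x, y) = ∑' z : V × V, g z.1 * F z := by
    rw [h1.tsum_prod]
    simp only [tsum_mul_left]
  refine ⟨?_, ?_, ?_⟩
  · simpa only [tsum_mul_left] using h1.prod
  · exact (h2.sub h1).congr fun z => by ring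
  · rw [h4, show (fun z : V × V => F z * (g z.2 - g z.1)) = fun z => g z.2 * F z - g z.1 * F z from
      funext fun z => by ring, h2.tsum_sub h1, h3]
    ring

namespace WeightedGraph

variable {V : Type*} (G : WeightedGraph V)

theorem deg_pos [Infinite V] (x : V) : 0 < G.deg x := by
  obtain ⟨y, hy⟩ := G.connected.preconnected.exists_adj_of_nontrivial x
  exact (G.summable_weight x).tsum_pos (G.weight_nonneg x) y ((G.weight_pos_iff x y).2 hy)

theorem deg_nonneg (x : V) : 0 ≤ G.deg x := tsum_nonneg (G.weight_nonneg x)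

theorem summable_fst {f : V → ℝ} (hf : Summable fun x => |f x| * G.deg x) :
    Summable fun z : V × V => |f z.1| * G.weight z.1 z.2 := by
  have h0 : 0 ≤ fun z : V × V => |f z.1| * G.weight z.1 z.2 :=
    fun z => mul_nonneg (abs_nonneg (f z.1)) (G.weight_nonneg z.1 z.2)
  refine (summable_prod_of_nonneg h0).2 ⟨fun x => (G.summable_weight x).mul_left |f x|, ?_⟩
  simp only [tsum_mul_left]
  exact hf

theorem summable_snd {f : V → ℝ} (hf : Summable fun x => |f x| * G.deg x) :
    Summable fun z : V × V => |f z.2| * G.weight z.1 z.2 := by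
  refine (G.summable_fst hf).prod_symm.congr fun z => ?_
  rw [Prod.fst_swap, Prod.snd_swap, G.weight_symm]

theorem tsum_fst {f : V → ℝ} (hf : Summable fun x => |f x| * G.deg x) :
    ∑' z : V × V, |f z.1| * G.weight z.1 z.2 = ∑' x, |f x| * G.deg x := by
  rw [(G.summable_fst hf).tsum_prod]
  simp only [tsum_mul_left]
  rfl

theorem tsum_snd {f : V → ℝ} (hf : Summable fun x => |f x| * G.deg x) :
    ∑' z : V × V, |f z.2| * G.weight z.1 z.2 = ∑' x, |f x| * G.deg x := by
  rw [← G.tsum_fst hf, ← (Equiv.prodComm V V).tsum_eq]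
  exact tsum_congr fun z => by simp [G.weight_symm z.2]

/-- The unnormalised `p`-Laplacian `d_ω Δ_p` with truncated flux. -/
noncomputable def truncLap (p K : ℝ) (f : V → ℝ) (x : V) : ℝ :=
  ∑' y, truncFlux p K (f y - f x) * G.weight x y

variable {p K : ℝ}

theorem summable_truncFlux (hp : 2 < p) (hK : 0 ≤ K) (f : V → ℝ) (x : V) :
    Summable fun y => truncFlux p K (f y - f x) * G.weight x y := by
  refine Summable.of_norm_bounded ((G.summable_weight x).mul_left (K ^ (p - 1))) fun y => ?_
  rw [Real.norm_eq_abs, abs_mul, abs_of_nonneg (G.weight_nonneg x y)]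
  exact mul_le_mul_of_nonneg_right (abs_truncFlux_le hp hK _) (G.weight_nonneg x y)

theorem summable_truncFlux_prod (hp : 2 < p) (hK : 0 ≤ K) {f : V → ℝ}
    (hf : Summable fun x => |f x| * G.deg x) :
    Summable fun z : V × V => truncFlux p K (f z.2 - f z.1) * G.weight z.1 z.2 := by
  have hL : 0 ≤ (p - 1) * K ^ (p - 2) := mul_nonneg (by linarith) (Real.rpow_nonneg hK _)
  refine Summable.of_norm_bounded (((G.summable_snd hf).add (G.summable_fst hf)).mul_left
    ((p - 1) * K ^ (p - 2))) fun z => ?_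
  rw [Real.norm_eq_abs, abs_mul, abs_of_nonneg (G.weight_nonneg _ _), ← add_mul, ← mul_assoc]
  refine mul_le_mul_of_nonneg_right ((abs_truncFlux_le_mul hp hK _).trans ?_) (G.weight_nonneg _ _)
  exact mul_le_mul_of_nonneg_left (abs_sub _ _) hL

theorem summable_truncLap (hp : 2 < p) (hK : 0 ≤ K) {f : V → ℝ}
    (hf : Summable fun x => |f x| * G.deg x) : Summable (G.truncLap p K f) :=
  (G.summable_truncFlux_prod hp hK hf).prod

theorem tsum_truncLap (hp : 2 < p) (hK : 0 ≤ K) {f : V → ℝ}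
    (hf : Summable fun x => |f x| * G.deg x) : ∑' x, G.truncLap p K f x = 0 := by
  have := (tsum_mul_tsum_eq_of_antisymm (G.summable_truncFlux_prod hp hK hf) (fun x y => by
    rw [G.weight_symm y x, ← neg_sub (f y) (f x), truncFlux_neg hK, neg_mul])
    (g := fun _ => 1) (B := 1) (fun _ => by simp)).2.2
  simpa [truncLap] using this

/-- The truncated operator is Lipschitz on the weighted space `ℓ¹(V)`. -/
theorem tsum_abs_truncLap_sub_le (hp : 2 < p) (hK : 0 ≤ K) {f g : V → ℝ}
    (hfg : Summable fun x => |f x - g x| * G.deg x) :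
    (Summable fun x => |G.truncLap p K f x - G.truncLap p K g x|) ∧
    ∑' x, |G.truncLap p K f x - G.truncLap p K g x| ≤
      2 * ((p - 1) * K ^ (p - 2)) * ∑' x, |f x - g x| * G.deg x := by
  set L := (p - 1) * K ^ (p - 2) with hLdef
  have hL : 0 ≤ L := mul_nonneg (by linarith) (Real.rpow_nonneg hK _)
  set e : V → ℝ := fun x => f x - g x with he
  have hs := (((G.summable_snd (f := e) hfg).add (G.summable_fst (f := e) hfg)).mul_left L)
  have hpt : ∀ x, |G.truncLap p K f x - G.truncLap p K g x| ≤
      ∑' y, L * (|e y| * G.weight x y + |e x| * G.weight x y) := fun x => by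
    rw [truncLap, truncLap, ← (G.summable_truncFlux hp hK f x).tsum_sub
      (G.summable_truncFlux hp hK g x), ← Real.norm_eq_abs]
    refine tsum_of_norm_bounded (hs.prod_factor x).hasSum fun y => ?_
    rw [Real.norm_eq_abs, ← sub_mul, abs_mul, abs_of_nonneg (G.weight_nonneg x y), ← add_mul,
      ← mul_assoc]
    refine mul_le_mul_of_nonneg_right ((abs_truncFlux_sub_le hp hK _ _).trans ?_)
      (G.weight_nonneg x y)
    refine mul_le_mul_of_nonneg_left ?_ hL
    rw [show f y - f x - (g y - g x) = e y - e x by simp only [he]; ring]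
    exact abs_sub _ _
  have hsum := Summable.of_nonneg_of_le (fun x => abs_nonneg _) hpt hs.prod
  refine ⟨hsum, (hsum.tsum_le_tsum hpt hs.prod).trans (le_of_eq ?_)⟩
  rw [← hs.tsum_prod, tsum_mul_left, (G.summable_snd (f := e) hfg).tsum_add
    (G.summable_fst (f := e) hfg), G.tsum_fst (f := e) hfg, G.tsum_snd (f := e) hfg]
  ring

theorem pLaplacian_eq {f : V → ℝ} (hf : ∀ x y, |f y - f x| ≤ K) (x : V) :
    G.pLaplacian p f x = G.truncLap p K f x / G.deg x := by
  rw [pLaplacian, truncLap, one_div, inv_mul_eq_div]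
  congr 2
  funext y
  rw [truncFlux_eq (hf x y), pFlux]

end WeightedGraph

/-! ### Comparison of bounded solutions -/

/-- A maximum principle without compactness: a bounded family of functions starting below `0`
stays below `0` if, wherever a member is positive, its growth rate is controlled by the supremum
of the whole family. -/
theorem nonpos_of_deriv_le {V : Type*} {w w' : V → ℝ → ℝ} {T L B : ℝ} (hL : 0 ≤ L)
    (hbd : ∀ x, ∀ t ∈ Icc 0 T, w x t ≤ B)
    (hcont : ∀ x, ContinuousOn (w x) (Icc 0 T))
    (hderiv : ∀ x, ∀ t ∈ Ioo 0 T, HasDerivAt (w x) (w' x t) t)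
    (hbound : ∀ x, ∀ t ∈ Ioo 0 T, ∀ S, (∀ y, w y t ≤ S) → 0 < w x t → w' x t ≤ L * S)
    (h0 : ∀ x, w x 0 ≤ 0) : ∀ x, ∀ t ∈ Icc 0 T, w x t ≤ 0 := by
  set c : ℝ := 2 * L + 1
  have hc : 0 < c := by positivity
  -- The rate `c > 2L` lets the barrier `S exp (c t)` be halved without being crossed.
  have key : ∀ S : ℝ, 0 < S → (∀ x, ∀ t ∈ Icc 0 T, w x t ≤ S * Real.exp (c * t)) →
      ∀ x, ∀ t ∈ Icc 0 T, w x t ≤ S / 2 * Real.exp (c * t) := by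
    intro S hS hw x t ht
    have hbar : ∀ s : ℝ, 0 ≤ s → S / 2 ≤ S / 2 * Real.exp (c * s) := fun s hs =>
      le_mul_of_one_le_right (by linarith) (Real.one_le_exp (by positivity))
    rcases ht.1.eq_or_lt with rfl | ht0
    · linarith [h0 x, hbar 0 le_rfl]
    obtain ⟨a, hat, ha0⟩ : ∃ a, w x a < S / 2 ∧ a ∈ Ioo 0 t := by
      have h1 : ContinuousWithinAt (w x) (Ioo 0 t) 0 :=
        (hcont x 0 ⟨le_rfl, ht.1.trans ht.2⟩).mono fun s hs => ⟨hs.1.le, hs.2.le.trans ht.2⟩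
      have h2 : ∀ᶠ s in nhdsWithin 0 (Ioo 0 t), w x s < S / 2 :=
        h1.eventually_lt_const (by linarith [h0 x])
      have : (nhdsWithin (0 : ℝ) (Ioo 0 t)).NeBot := left_nhdsWithin_Ioo_neBot ht0
      exact (h2.and self_mem_nhdsWithin).exists
    have hB : ∀ s, HasDerivAt (fun s => S / 2 * Real.exp (c * s))
        (S / 2 * (Real.exp (c * s) * c)) s := fun s => by
      simpa using (((hasDerivAt_id s).const_mul c).exp).const_mul (S / 2)
    refine image_le_of_deriv_right_lt_deriv_boundary (f := w x) (f' := w' x) (a := a) (b := t)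
      ((hcont x).mono fun s hs => ⟨ha0.1.le.trans hs.1, hs.2.trans ht.2⟩)
      (fun s hs => (hderiv x s ⟨ha0.1.trans_le hs.1, hs.2.trans_le ht.2⟩).hasDerivWithinAt)
      (hat.le.trans (hbar a ha0.1.le)) hB ?_ (right_mem_Icc.2 ha0.2.le)
    intro s hs hsw
    have hs0 : 0 < s := ha0.1.trans_le hs.1
    have hsT : s < T := hs.2.trans_le ht.2
    have hE : 0 < Real.exp (c * s) := Real.exp_pos _
    have := hbound x s ⟨hs0, hsT⟩ (S * Real.exp (c * s)) (fun y => hw y s ⟨hs0.le, hsT.le⟩)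
      (by rw [hsw]; positivity)
    refine this.trans_lt ?_
    have : 0 < S * Real.exp (c * s) := by positivity
    simp only [c]
    nlinarith
  have hn : ∀ n : ℕ, ∀ x, ∀ t ∈ Icc 0 T,
      w x t ≤ (max B 0 + 1) * (1 / 2) ^ n * Real.exp (c * t) := by
    intro n
    have hS : 0 < max B 0 + 1 := by positivity
    induction n with
    | zero =>
      intro x t ht
      have h1 : max B 0 + 1 ≤ (max B 0 + 1) * Real.exp (c * t) :=
        le_mul_of_one_le_right hS.le (Real.one_le_exp (mul_nonneg hc.le ht.1))
      simp only [pow_zero, mul_one]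
      linarith [hbd x t ht, le_max_left B 0]
    | succ n ih =>
      intro x t ht
      refine (key _ (by positivity) ih x t ht).trans (le_of_eq ?_)
      rw [pow_succ]; ring
  intro x t ht
  have hlim : Filter.Tendsto
      (fun n : ℕ => (max B 0 + 1) * (1 / 2 : ℝ) ^ n * Real.exp (c * t)) Filter.atTop (nhds 0) := by
    have h := ((tendsto_pow_atTop_nhds_zero_of_lt_one (r := (1 / 2 : ℝ)) (by norm_num)
      (by norm_num)).const_mul (max B 0 + 1)).mul_const (Real.exp (c * t))
    simpa using h
  exact ge_of_tendsto' hlim fun n => hn n x t ht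

namespace WeightedGraph

variable {V : Type*} (G : WeightedGraph V) {p K : ℝ}

theorem truncLap_sub_le (hp : 2 < p) (hK : 0 ≤ K) {f g : V → ℝ} {S : ℝ} {x : V}
    (hS : ∀ y, f y - g y ≤ S) (hx : 0 < f x - g x) :
    G.truncLap p K f x - G.truncLap p K g x ≤ (p - 1) * K ^ (p - 2) * S * G.deg x := by
  have hSpos : 0 ≤ S := hx.le.trans (hS x)
  rw [truncLap, truncLap, ← (G.summable_truncFlux hp hK f x).tsum_sub
    (G.summable_truncFlux hp hK g x), deg, ← tsum_mul_left]
  refine ((G.summable_truncFlux hp hK f x).sub (G.summable_truncFlux hp hK g x)).tsum_le_tsum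
    (fun y => ?_) ((G.summable_weight x).mul_left _)
  rw [← sub_mul]
  refine mul_le_mul_of_nonneg_right ?_ (G.weight_nonneg x y)
  have h1 : truncFlux p K (f y - f x) ≤ truncFlux p K (g y - g x + S) :=
    monotone_truncFlux hp K (by linarith [hS y])
  have h2 := truncFlux_sub_le (s := g y - g x) (t := g y - g x + S) hp hK (by linarith)
  rw [add_sub_cancel_left] at h2
  linarith

/-- Comparison for the truncated flow with a bounded time-dependent speed `c`. -/
theorem le_of_truncLap_flow [Infinite V] (hp : 2 < p) (hK : 0 ≤ K) {u v : V → ℝ → ℝ} {c : ℝ → ℝ}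
    {T B C : ℝ} (hc : ∀ t ∈ Ioo 0 T, 0 ≤ c t) (hcC : ∀ t ∈ Ioo 0 T, c t ≤ C)
    (hbd : ∀ x, ∀ t ∈ Icc 0 T, u x t - v x t ≤ B)
    (hu : ∀ x, ContinuousOn (u x) (Icc 0 T)) (hv : ∀ x, ContinuousOn (v x) (Icc 0 T))
    (hu' : ∀ x, ∀ t ∈ Ioo 0 T,
      HasDerivAt (u x) (c t * (G.truncLap p K (fun y => u y t) x / G.deg x)) t)
    (hv' : ∀ x, ∀ t ∈ Ioo 0 T,
      HasDerivAt (v x) (c t * (G.truncLap p K (fun y => v y t) x / G.deg x)) t)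
    (h0 : ∀ x, u x 0 ≤ v x 0) : ∀ x, ∀ t ∈ Icc 0 T, u x t ≤ v x t := by
  intro x t ht
  rcases ht.1.eq_or_lt with rfl | ht0
  · exact h0 x
  have hC : 0 ≤ C := by
    have hm : t / 2 ∈ Ioo 0 T := ⟨by linarith, by linarith [ht.2]⟩
    exact (hc _ hm).trans (hcC _ hm)
  have hL : 0 ≤ (p - 1) * K ^ (p - 2) := mul_nonneg (by linarith) (Real.rpow_nonneg hK _)
  have := nonpos_of_deriv_le (w := fun x t => u x t - v x t) (mul_nonneg hC hL) hbd
    (fun x => (hu x).sub (hv x)) (fun x t ht => (hu' x t ht).sub (hv' x t ht)) ?_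
    (fun x => sub_nonpos.2 (h0 x)) x t ht
  · simpa using this
  · intro x t ht S hS hx
    rw [← mul_sub, ← sub_div, mul_assoc]
    have h1 := G.truncLap_sub_le (f := fun y => u y t) (g := fun y => v y t) hp hK hS hx
    have hSpos : 0 ≤ S := hx.le.trans (hS x)
    have h2 : (G.truncLap p K (fun y => u y t) x - G.truncLap p K (fun y => v y t) x) / G.deg x ≤
        (p - 1) * K ^ (p - 2) * S := by
      rwa [div_le_iff₀ (G.deg_pos x)]
    calc _ ≤ c t * ((p - 1) * K ^ (p - 2) * S) := mul_le_mul_of_nonneg_left h2 (hc t ht)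
      _ ≤ _ := mul_le_mul_of_nonneg_right (hcC t ht) (by positivity)

/-- Comparison for bounded solutions of the `p`-Laplacian flow. -/
theorem le_of_pLaplacian_flow [Infinite V] (hp : 2 < p) {u v : V → ℝ → ℝ} {T R : ℝ}
    (hub : ∀ x, ∀ t ∈ Icc 0 T, |u x t| ≤ R) (hvb : ∀ x, ∀ t ∈ Icc 0 T, |v x t| ≤ R)
    (hu : ∀ x, ContinuousOn (u x) (Icc 0 T)) (hv : ∀ x, ContinuousOn (v x) (Icc 0 T))
    (hu' : ∀ x, ∀ t ∈ Ioo 0 T, HasDerivAt (u x) (G.pLaplacian p (fun y => u y t) x) t)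
    (hv' : ∀ x, ∀ t ∈ Ioo 0 T, HasDerivAt (v x) (G.pLaplacian p (fun y => v y t) x) t)
    (h0 : ∀ x, u x 0 ≤ v x 0) : ∀ x, ∀ t ∈ Icc 0 T, u x t ≤ v x t := by
  intro x t ht
  have hR : 0 ≤ 2 * R := by linarith [(abs_nonneg _).trans (hub x t ht)]
  have hdiff : ∀ f : V → ℝ, (∀ x, |f x| ≤ R) → ∀ x y, |f y - f x| ≤ 2 * R := fun f hf x y =>
    (abs_sub _ _).trans (by linarith [hf x, hf y])
  refine G.le_of_truncLap_flow (K := 2 * R) hp hR (c := fun _ => 1) (C := 1) (B := 2 * R)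
    (fun _ _ => zero_le_one) (fun _ _ => le_rfl)
    (fun x t ht => by
      linarith [(abs_le.1 (hub x t ht)).2, (abs_le.1 (hvb x t ht)).1]) hu hv ?_ ?_ h0 x t ht
  · intro x t ht
    rw [one_mul, ← G.pLaplacian_eq (hdiff _ fun x => hub x t ⟨ht.1.le, ht.2.le⟩)]
    exact hu' x t ht
  · intro x t ht
    rw [one_mul, ← G.pLaplacian_eq (hdiff _ fun x => hvb x t ⟨ht.1.le, ht.2.le⟩)]
    exact hv' x t ht

end WeightedGraph

/-! ### Existence in `ℓ¹` -/

/-- A Lipschitz field vanishing at `0` becomes bounded and stays Lipschitz when divided by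
`1 + ‖x‖`, so the Picard–Lindelöf theorem applies on intervals of any length. -/
theorem exists_hasDerivWithinAt_normalized {E : Type*} [NormedAddCommGroup E] [NormedSpace ℝ E]
    [CompleteSpace E] {Φ : E → E} {C M T : ℝ} (hC : 0 ≤ C) (hM : 0 ≤ M) (hT : 0 ≤ T)
    (hΦ : ∀ x y, ‖Φ x - Φ y‖ ≤ C * ‖x - y‖) (h0 : Φ 0 = 0) (x₀ : E) :
    ∃ α : ℝ → E, α 0 = x₀ ∧ ∀ t ∈ Icc (-T) T,
      HasDerivWithinAt α (((1 + M) * (1 + ‖α t‖)⁻¹) • Φ (α t)) (Icc (-T) T) t := by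
  have hΦ0 : ∀ x, ‖Φ x‖ ≤ C * ‖x‖ := fun x => by simpa [h0] using hΦ x 0
  have hpos : ∀ x : E, 0 < 1 + ‖x‖ := fun x => by positivity
  have hlip : ∀ x y : E, ‖((1 + M) * (1 + ‖x‖)⁻¹) • Φ x - ((1 + M) * (1 + ‖y‖)⁻¹) • Φ y‖ ≤
      (1 + M) * (2 * C) * ‖x - y‖ := fun x y => by
    rw [mul_smul, mul_smul, ← smul_sub, norm_smul, Real.norm_of_nonneg (by positivity), mul_assoc]
    refine mul_le_mul_of_nonneg_left ?_ (by positivity)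
    have hsplit : (1 + ‖x‖)⁻¹ • Φ x - (1 + ‖y‖)⁻¹ • Φ y =
        (1 + ‖x‖)⁻¹ • (Φ x - Φ y) + ((1 + ‖x‖)⁻¹ - (1 + ‖y‖)⁻¹) • Φ y := by
      rw [smul_sub, sub_smul]; abel
    rw [hsplit]
    have h1 : ‖(1 + ‖x‖)⁻¹ • (Φ x - Φ y)‖ ≤ C * ‖x - y‖ := by
      rw [norm_smul, Real.norm_of_nonneg (by positivity)]
      exact (mul_le_of_le_one_left (norm_nonneg _)
        (inv_le_one_of_one_le₀ (by linarith [norm_nonneg x]))).trans (hΦ x y)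
    have h2 : ‖((1 + ‖x‖)⁻¹ - (1 + ‖y‖)⁻¹) • Φ y‖ ≤ C * ‖x - y‖ := by
      rw [norm_smul, Real.norm_eq_abs, inv_sub_inv (hpos x).ne' (hpos y).ne', abs_div,
        abs_of_pos (mul_pos (hpos x) (hpos y)), div_mul_eq_mul_div,
        div_le_iff₀ (mul_pos (hpos x) (hpos y))]
      have h3 : |1 + ‖y‖ - (1 + ‖x‖)| ≤ ‖x - y‖ := by
        rw [show 1 + ‖y‖ - (1 + ‖x‖) = ‖y‖ - ‖x‖ by ring, abs_sub_comm]
        exact abs_norm_sub_norm_le x y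
      have h4 : ‖Φ y‖ ≤ C * ((1 + ‖x‖) * (1 + ‖y‖)) := by
        refine (hΦ0 y).trans (mul_le_mul_of_nonneg_left ?_ hC)
        nlinarith [norm_nonneg x, norm_nonneg y, mul_nonneg (norm_nonneg x) (norm_nonneg y)]
      calc _ ≤ ‖x - y‖ * (C * ((1 + ‖x‖) * (1 + ‖y‖))) :=
            mul_le_mul h3 h4 (norm_nonneg _) (norm_nonneg _)
        _ = _ := by ring
    linarith [norm_add_le ((1 + ‖x‖)⁻¹ • (Φ x - Φ y)) (((1 + ‖x‖)⁻¹ - (1 + ‖y‖)⁻¹) • Φ y)]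
  have hbd : ∀ x : E, ‖((1 + M) * (1 + ‖x‖)⁻¹) • Φ x‖ ≤ (1 + M) * C := fun x => by
    rw [norm_smul, Real.norm_of_nonneg (by have := hpos x; positivity), mul_assoc]
    refine mul_le_mul_of_nonneg_left ?_ (by positivity)
    rw [inv_mul_le_iff₀ (hpos x)]
    linarith [hΦ0 x]
  have hPL : IsPicardLindelof (fun _ : ℝ => fun x : E => ((1 + M) * (1 + ‖x‖)⁻¹) • Φ x)
      (tmin := -T) (tmax := T) ⟨0, by constructor <;> linarith⟩ x₀
      (Real.toNNReal ((1 + M) * C * T)) 0 (Real.toNNReal ((1 + M) * C))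
      (Real.toNNReal ((1 + M) * (2 * C))) := by
    refine IsPicardLindelof.of_time_independent (fun x _ => ?_) ?_ ?_
    · rw [Real.coe_toNNReal _ (by positivity)]; exact hbd x
    · refine LipschitzOnWith.of_dist_le_mul fun x _ y _ => ?_
      rw [dist_eq_norm, dist_eq_norm, Real.coe_toNNReal _ (by positivity)]
      exact hlip x y
    · rw [Real.coe_toNNReal _ (by positivity), Real.coe_toNNReal _ (by positivity)]
      simp
  exact hPL.exists_eq_forall_mem_Icc_hasDerivWithinAt₀

namespace WeightedGraph

variable {V : Type*} (G : WeightedGraph V) {p : ℝ}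

/-- Existence on `[0, T]` for bounded data, with the maximum principle and conservation of mass.
The unknown is `x ↦ u(x, t) d_ω(x)` in the unweighted space `ℓ¹`, for the field divided by
`1 + ‖·‖`; a positive solution has constant norm, so this normalisation is a constant factor. -/
theorem exists_flow [Infinite V] (hp : 2 < p) {δ : ℝ} (hδ : 0 < δ) (hdeg : ∀ x, δ ≤ G.deg x)
    {u₀ : V → ℝ} {R T : ℝ} (hT : 0 < T) (h0 : ∀ x, 0 ≤ u₀ x) (hR : ∀ x, u₀ x ≤ R)
    (hs : Summable fun x => u₀ x * G.deg x) :
    ∃ u : V → ℝ → ℝ, (∀ x, u x 0 = u₀ x) ∧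
      (∀ t ∈ Icc 0 T, (∀ x, 0 ≤ u x t) ∧ (∀ x, u x t ≤ R) ∧
        (Summable fun x => u x t * G.deg x) ∧
        ∑' x, u x t * G.deg x = ∑' x, u₀ x * G.deg x) ∧
      (∀ x, ContDiffOn ℝ 1 (u x) (Icc 0 T)) ∧
      ∀ x, ∀ t ∈ Ioo 0 T, HasDerivAt (u x) (G.pLaplacian p (fun y => u y t) x) t := by
  have hd : ∀ x, 0 < G.deg x := G.deg_pos
  obtain ⟨o⟩ : Nonempty V := inferInstance
  have hR0 : 0 ≤ R := (h0 o).trans (hR o)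
  set M : ℝ := ∑' x, u₀ x * G.deg x
  have hM : 0 ≤ M := tsum_nonneg fun x => mul_nonneg (h0 x) (hd x).le
  set L : ℝ := (p - 1) * R ^ (p - 2)
  have hL : 0 ≤ L := mul_nonneg (by linarith) (Real.rpow_nonneg hR0 _)
  have hmem : ∀ f : V → ℝ, Summable (fun x => |f x|) → Memℓp (E := fun _ : V => ℝ) f 1 :=
    fun f hf => memℓp_gen (by simpa using hf)
  have hsumm : ∀ g : lp (fun _ : V => ℝ) 1, Summable fun x => |g x| := fun g => by
    simpa using (lp.memℓp g).summable (by simp)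
  have hnorm : ∀ g : lp (fun _ : V => ℝ) 1, ‖g‖ = ∑' x, |g x| := fun g => by
    rw [lp.norm_eq_tsum_rpow (by simp)]; simp
  have hcoef : ∀ (g : V → ℝ) x, |g x / G.deg x| * G.deg x = |g x| := fun g x => by
    rw [abs_div, abs_of_pos (hd x), div_mul_cancel₀ _ (hd x).ne']
  have hsumm' : ∀ g : lp (fun _ : V => ℝ) 1, Summable fun x => |g x / G.deg x| * G.deg x :=
    fun g => by simpa only [hcoef] using hsumm g
  let Φ : lp (fun _ : V => ℝ) 1 → lp (fun _ : V => ℝ) 1 := fun g =>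
    ⟨G.truncLap p R fun x => g x / G.deg x,
      hmem _ (G.summable_truncLap hp hR0 (hsumm' g)).abs⟩
  have hΦ : ∀ g h, ‖Φ g - Φ h‖ ≤ 2 * L * ‖g - h‖ := fun g h => by
    have hdist : ∀ x, |g x / G.deg x - h x / G.deg x| * G.deg x = |g x - h x| := fun x => by
      rw [← sub_div, hcoef (fun x => g x - h x)]
    have := (G.tsum_abs_truncLap_sub_le hp hR0 (f := fun x => g x / G.deg x)
      (g := fun x => h x / G.deg x) (by simp only [hdist]; exact hsumm (g - h))).2
    simp only [hdist] at this
    rw [hnorm, hnorm]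
    exact this
  have hΦ0 : Φ 0 = 0 := by
    ext x
    change G.truncLap p R (fun x => (0 : lp (fun _ : V => ℝ) 1) x / G.deg x) x = 0
    simp [truncLap, truncFlux_zero hR0]
  obtain ⟨α, hα0, hα⟩ := exists_hasDerivWithinAt_normalized (M := M) (T := T + 1)
    (mul_nonneg zero_le_two hL) hM (by linarith) hΦ hΦ0
    ⟨fun x => u₀ x * G.deg x, hmem _ hs.abs⟩
  set c : ℝ → ℝ := fun t => (1 + M) * (1 + ‖α t‖)⁻¹
  have hderiv : ∀ t ∈ Icc 0 T, HasDerivAt α (c t • Φ (α t)) t := fun t ht =>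
    (hα t ⟨by linarith [ht.1], by linarith [ht.2]⟩).hasDerivAt
      (Icc_mem_nhds (by linarith [ht.1]) (by linarith [ht.2]))
  have hαc : ContinuousOn α (Icc 0 T) := fun t ht => (hderiv t ht).continuousAt.continuousWithinAt
  set u : V → ℝ → ℝ := fun x t => α t x / G.deg x with hu
  have hu' : ∀ x, ∀ t ∈ Icc 0 T,
      HasDerivAt (u x) (c t * (G.truncLap p R (fun y => u y t) x / G.deg x)) t := by
    intro x t ht
    have h1 := ((lp.evalCLM ℝ (fun _ : V => ℝ) 1 x).hasFDerivAt.comp_hasDerivAt t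
      (hderiv t ht)).div_const (G.deg x)
    rw [← mul_div_assoc]
    exact h1
  have huc : ∀ x, ContinuousOn (u x) (Icc 0 T) := fun x t ht =>
    (hu' x t ht).continuousAt.continuousWithinAt
  have hc0 : ∀ t, 0 ≤ c t := fun t => by positivity
  have hcM : ∀ t, c t ≤ 1 + M := fun t =>
    mul_le_of_le_one_right (by positivity)
      (inv_le_one_of_one_le₀ (by linarith [norm_nonneg (α t)]))
  have hinit : ∀ x, u x 0 = u₀ x := fun x => by
    simp only [hu, hα0]
    exact mul_div_cancel_right₀ _ (hd x).ne'
  obtain ⟨B, hB⟩ := isCompact_Icc.exists_bound_of_continuousOn hαc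
  have hub : ∀ x, ∀ t ∈ Icc 0 T, |u x t| ≤ B / δ := fun x t ht => by
    simp only [hu]
    rw [abs_div, abs_of_pos (hd x)]
    exact div_le_div₀ ((norm_nonneg _).trans (hB t ht))
      ((lp.norm_apply_le_norm one_ne_zero (α t) x).trans (hB t ht)) hδ (hdeg x)
  have hconst : ∀ k : ℝ, ∀ x t, HasDerivAt (fun _ : ℝ => k)
      (c t * (G.truncLap p R (fun _ => k) x / G.deg x)) t := fun k x t => by
    simpa [truncLap, truncFlux_zero hR0] using hasDerivAt_const t k
  have hnn : ∀ x, ∀ t ∈ Icc 0 T, 0 ≤ u x t :=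
    G.le_of_truncLap_flow (u := fun _ _ => 0) (v := u) (c := c) (B := B / δ) hp hR0
      (fun t _ => hc0 t) (fun t _ => hcM t)
      (fun x t ht => by linarith [(abs_le.1 (hub x t ht)).1])
      (fun x => continuousOn_const) huc (fun x t _ => hconst 0 x t)
      (fun x t ht => hu' x t ⟨ht.1.le, ht.2.le⟩) (fun x => by rw [hinit]; exact h0 x)
  have hle : ∀ x, ∀ t ∈ Icc 0 T, u x t ≤ R :=
    G.le_of_truncLap_flow (u := u) (v := fun _ _ => R) (c := c) (B := B / δ) hp hR0
      (fun t _ => hc0 t) (fun t _ => hcM t)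
      (fun x t ht => by linarith [(abs_le.1 (hub x t ht)).2])
      huc (fun x => continuousOn_const) (fun x t ht => hu' x t ⟨ht.1.le, ht.2.le⟩)
      (fun x t _ => hconst R x t) (fun x => by rw [hinit]; exact hR x)
  have hmul : ∀ x t, u x t * G.deg x = α t x := fun x t => div_mul_cancel₀ _ (hd x).ne'
  have hmass : ∀ t ∈ Icc 0 T, ∑' x, α t x = M := by
    have hm : ∀ t ∈ Icc 0 T, HasDerivAt (fun t => ∑' x, α t x) 0 t := fun t ht => by
      have h1 := (lp.tsumCLM ℝ V ℝ).hasFDerivAt.comp_hasDerivAt t (hderiv t ht)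
      have h2 : lp.tsumCLM ℝ V ℝ (c t • Φ (α t)) = 0 := by
        rw [map_smul, lp.tsumCLM_apply]
        have : ∑' x, Φ (α t) x = 0 := G.tsum_truncLap hp hR0 (hsumm' (α t))
        rw [this, smul_zero]
      rw [h2] at h1
      exact h1
    intro t ht
    rw [constant_of_has_deriv_right_zero
      (fun s hs => (hm s hs).continuousAt.continuousWithinAt)
      (fun s hs => (hm s ⟨hs.1, hs.2.le⟩).hasDerivWithinAt) t ht, hα0]
  have hnormM : ∀ t ∈ Icc 0 T, ‖α t‖ = M := fun t ht => by
    rw [hnorm, ← hmass t ht]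
    exact tsum_congr fun x => abs_of_nonneg (by
      rw [← hmul]; exact mul_nonneg (hnn x t ht) (hd x).le)
  have hc1 : ∀ t ∈ Icc 0 T, c t = 1 := fun t ht => by
    simp only [c, hnormM t ht]
    exact mul_inv_cancel₀ (by positivity)
  refine ⟨u, hinit, fun t ht => ⟨fun x => hnn x t ht, fun x => hle x t ht, ?_, ?_⟩,
    fun x => ?_, fun x t ht => ?_⟩
  · simp only [hmul]
    exact (hsumm (α t)).of_abs
  · simp only [hmul]
    exact hmass t ht
  · refine (contDiffOn_one_iff_derivWithin (uniqueDiffOn_Icc hT)).2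
      ⟨fun t ht => (hu' x t ht).differentiableAt.differentiableWithinAt, ?_⟩
    have hΦc : Continuous Φ := by
      refine (LipschitzWith.of_dist_le_mul (K := Real.toNNReal (2 * L)) fun g h => ?_).continuous
      rw [dist_eq_norm, dist_eq_norm, Real.coe_toNNReal _ (by positivity)]
      exact hΦ g h
    have hcomp : ContinuousOn (fun t => lp.evalCLM ℝ (fun _ : V => ℝ) 1 x (Φ (α t)) / G.deg x)
        (Icc 0 T) :=
      (((lp.evalCLM ℝ (fun _ : V => ℝ) 1 x).continuous.comp hΦc).comp_continuousOn hαc).div_const _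
    refine hcomp.congr fun t ht => ?_
    rw [(hu' x t ht).hasDerivWithinAt.derivWithin (uniqueDiffOn_Icc hT t ht), hc1 t ht, one_mul]
    rfl
  · have ht' : t ∈ Icc 0 T := ⟨ht.1.le, ht.2.le⟩
    have h1 := hu' x t ht'
    rw [hc1 t ht', one_mul, ← G.pLaplacian_eq] at h1
    · exact h1
    · intro x y
      exact abs_le.2 ⟨by linarith [hnn y t ht', hle x t ht'], by linarith [hle y t ht', hnn x t ht']⟩

end WeightedGraph

namespace WeightedGraph

variable {V : Type*} (G : WeightedGraph V) {p N : ℝ} {Λ : ℝ → ℝ}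

/-! ### The Faber–Krahn inequality in summed form -/

theorem summable_abs_sub_rpow {q B : ℝ} (hq : 1 ≤ q) {f : V → ℝ} (hB : ∀ x, |f x| ≤ B)
    (hf : Summable fun x => |f x| * G.deg x) :
    Summable fun z : V × V => |f z.2 - f z.1| ^ q * G.weight z.1 z.2 := by
  refine Summable.of_nonneg_of_le
    (fun z => mul_nonneg (Real.rpow_nonneg (abs_nonneg _) _) (G.weight_nonneg _ _)) (fun z => ?_)
    (((G.summable_snd hf).add (G.summable_fst hf)).mul_left ((2 * B) ^ (q - 1)))
  rw [← add_mul, ← mul_assoc]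
  refine mul_le_mul_of_nonneg_right ?_ (G.weight_nonneg _ _)
  have h1 := abs_sub (f z.2) (f z.1)
  rcases (abs_nonneg (f z.2 - f z.1)).eq_or_lt with h | h
  · rw [← h, Real.zero_rpow (by linarith)]
    have : 0 ≤ 2 * B := by linarith [(abs_nonneg _).trans (hB z.1)]
    positivity
  · calc |f z.2 - f z.1| ^ q = |f z.2 - f z.1| ^ (q - 1) * |f z.2 - f z.1| := by
          rw [← Real.rpow_add_one h.ne', sub_add_cancel]
      _ ≤ _ := mul_le_mul (Real.rpow_le_rpow h.le (by linarith [hB z.1, hB z.2]) (by linarith)) h1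
          h.le (Real.rpow_nonneg (by linarith [(abs_nonneg _).trans (hB z.1)]) _)

variable {G}

theorem FaberKrahn.le_tsum (hFK : G.FaberKrahn p Λ) {U : Finset V} (hU : 0 < G.vol U) {f : V → ℝ}
    (hf : ∀ x, x ∉ U → f x = 0)
    (hs : Summable fun z : V × V => |f z.2 - f z.1| ^ p * G.weight z.1 z.2) :
    Λ (G.vol U) * ∑ x ∈ U, |f x| ^ p * G.deg x ≤
      ∑' z : V × V, |f z.2 - f z.1| ^ p * G.weight z.1 z.2 :=
  (hFK _ hU U rfl f hf).trans (Summable.tsum_subtype_le _ _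
    (fun _ => mul_nonneg (Real.rpow_nonneg (abs_nonneg _) _) (G.weight_nonneg _ _)) hs)

/-- The Faber–Krahn inequality of single vertices forces the degrees to be bounded below, because
`Λ(v)` blows up as `v → 0`. -/
theorem FaberKrahn.exists_le_deg [Infinite V] {κ : ℝ} (hFK : G.FaberKrahn p Λ) (hp : 2 < p)
    (hN : 0 < N) (hΛ : FaberKrahnFunction p N κ Λ) : ∃ δ, 0 < δ ∧ ∀ x, δ ≤ G.deg x := by
  classical
  have hL : 0 < Λ 1 := hΛ.pos 1 one_pos
  have hpN : 0 < p / N := div_pos (by linarith) hN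
  refine ⟨min 1 ((Λ 1 / 2) ^ (p / N)⁻¹), lt_min one_pos (Real.rpow_pos_of_pos (by positivity) _),
    fun x => ?_⟩
  have hd := G.deg_pos x
  have hvol : G.vol {x} = G.deg x := by simp [vol]
  set f : V → ℝ := Pi.single x 1 with hfdef
  have hfx : f x = 1 := by simp [hfdef]
  have hf0 : ∀ y, y ≠ x → f y = 0 := fun y hy => by simp [hfdef, hy]
  have hf01 : ∀ y, 0 ≤ f y ∧ f y ≤ 1 := fun y => by
    rcases eq_or_ne y x with rfl | hy
    · simp [hfx]
    · simp [hf0 y hy]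
  have hf1 : ∀ y, |f y| ≤ 1 := fun y => by rw [abs_of_nonneg (hf01 y).1]; exact (hf01 y).2
  have hsum : HasSum (fun y => |f y| * G.deg y) (G.deg x) := by
    have := hasSum_single (f := fun y => |f y| * G.deg y) x (fun y hy => by simp [hf0 y hy])
    simpa [hfx] using this
  have hs := G.summable_abs_sub_rpow (q := p) (by linarith) hf1 hsum.summable
  have h1 := hFK.le_tsum (U := {x}) (f := f) (by rwa [hvol])
    (fun y hy => hf0 y (by simpa using hy)) hs
  have h2 : ∑' z : V × V, |f z.2 - f z.1| ^ p * G.weight z.1 z.2 ≤ 2 * G.deg x := by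
    have h3 := (G.summable_snd hsum.summable).add (G.summable_fst hsum.summable)
    refine (hs.tsum_le_tsum (fun z => ?_) h3).trans (le_of_eq ?_)
    · rw [← add_mul]
      refine mul_le_mul_of_nonneg_right ?_ (G.weight_nonneg _ _)
      refine le_trans ?_ (abs_sub _ _)
      refine (Real.rpow_le_rpow_of_exponent_ge_of_imp (abs_nonneg _)
        (abs_le.2 ⟨?_, ?_⟩) (show (1 : ℝ) ≤ p by linarith) ?_).trans (Real.rpow_one _).le
      · linarith [(hf01 z.1).2, (hf01 z.2).1]
      · linarith [(hf01 z.1).1, (hf01 z.2).2]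
      · intro _ h; linarith
    · rw [(G.summable_snd hsum.summable).tsum_add (G.summable_fst hsum.summable),
        G.tsum_fst hsum.summable, G.tsum_snd hsum.summable, hsum.tsum_eq]
      ring
  rw [hvol, Finset.sum_singleton, hfx, abs_one, Real.one_rpow, one_mul] at h1
  have h3 : Λ (G.deg x) ≤ 2 := le_of_mul_le_mul_right (h1.trans h2) hd
  rcases le_total 1 (G.deg x) with h | h
  · exact (min_le_left _ _).trans h
  refine (min_le_right _ _).trans ?_
  have h4 : (Λ (G.deg x))⁻¹ * G.deg x ^ (-(p / N)) ≤ (Λ 1)⁻¹ * 1 ^ (-(p / N)) :=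
    hΛ.lower_growth hd (mem_Ioi.2 one_pos) h
  have hΛd := hΛ.pos _ hd
  have hpow : 0 < G.deg x ^ (p / N) := Real.rpow_pos_of_pos hd _
  rw [Real.one_rpow, mul_one, Real.rpow_neg hd.le, ← mul_inv,
    inv_le_inv₀ (mul_pos hΛd hpow) hL] at h4
  have h5 : Λ 1 / 2 ≤ G.deg x ^ (p / N) := by
    nlinarith
  calc (Λ 1 / 2) ^ (p / N)⁻¹ ≤ (G.deg x ^ (p / N)) ^ (p / N)⁻¹ :=
        Real.rpow_le_rpow (by positivity) h5 (by positivity)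
    _ = G.deg x := Real.rpow_rpow_inv hd.le hpN.ne'

variable (G)

/-! ### The global solution, its uniqueness, and its one-sided time derivative bound -/

/-- A nonnegative solution for all times with constant mass, bounded by a constant `R`. -/
structure IsGlobalFlow (p R : ℝ) (u₀ : V → ℝ) (u : V → ℝ → ℝ) : Prop where
  initial : ∀ x, u x 0 = u₀ x
  nonneg : ∀ x, ∀ t, 0 ≤ t → 0 ≤ u x t
  le_bound : ∀ x, ∀ t, 0 ≤ t → u x t ≤ R
  summable : ∀ t, 0 ≤ t → Summable fun x => u x t * G.deg x
  mass : ∀ t, 0 ≤ t → ∑' x, u x t * G.deg x = ∑' x, u₀ x * G.deg x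
  contDiff : ∀ x, ∀ T, 0 < T → ContDiffOn ℝ 1 (u x) (Icc 0 T)
  equation : ∀ x, ∀ t, 0 < t → HasDerivAt (u x) (G.pLaplacian p (fun y => u y t) x) t

theorem exists_isGlobalFlow [Infinite V] (hp : 2 < p) {δ : ℝ} (hδ : 0 < δ)
    (hdeg : ∀ x, δ ≤ G.deg x) {u₀ : V → ℝ} {R : ℝ} (h0 : ∀ x, 0 ≤ u₀ x) (hR : ∀ x, u₀ x ≤ R)
    (hs : Summable fun x => u₀ x * G.deg x) : ∃ u, G.IsGlobalFlow p R u₀ u := by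
  have hex := fun n : ℕ => G.exists_flow hp hδ hdeg (T := (n : ℝ) + 1) (by positivity) h0 hR hs
  choose U hU0 hU hUc hUe using hex
  have hbd : ∀ (n : ℕ) x, ∀ t ∈ Icc (0 : ℝ) (n + 1), |U n x t| ≤ R := fun n x t ht => by
    rw [abs_of_nonneg ((hU n t ht).1 x)]; exact (hU n t ht).2.1 x
  have hagree : ∀ m n : ℕ, m ≤ n → ∀ x, ∀ t ∈ Icc (0 : ℝ) (m + 1), U m x t = U n x t := by
    intro m n hmn x t ht
    have hmn' : (m : ℝ) + 1 ≤ n + 1 := by exact_mod_cast Nat.succ_le_succ hmn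
    have hsub : Icc (0 : ℝ) (m + 1) ⊆ Icc (0 : ℝ) (n + 1) := Icc_subset_Icc_right hmn'
    have hsub' : Ioo (0 : ℝ) (m + 1) ⊆ Ioo (0 : ℝ) (n + 1) := Ioo_subset_Ioo_right hmn'
    exact le_antisymm
      (G.le_of_pLaplacian_flow hp (hbd m) (fun x t ht => hbd n x t (hsub ht))
        (fun x => (hUc m x).continuousOn) (fun x => (hUc n x).continuousOn.mono hsub)
        (hUe m) (fun x t ht => hUe n x t (hsub' ht)) (fun x => ((hU0 _ x).trans (hU0 _ x).symm).le) x t ht)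
      (G.le_of_pLaplacian_flow hp (fun x t ht => hbd n x t (hsub ht)) (hbd m)
        (fun x => (hUc n x).continuousOn.mono hsub) (fun x => (hUc m x).continuousOn)
        (fun x t ht => hUe n x t (hsub' ht)) (hUe m) (fun x => ((hU0 _ x).trans (hU0 _ x).symm).le) x t ht)
  set u : V → ℝ → ℝ := fun x t => U ⌈t⌉₊ x t
  have hu : ∀ n : ℕ, ∀ x, ∀ t ∈ Icc (0 : ℝ) n, u x t = U n x t := fun n x t ht =>
    hagree _ n (Nat.ceil_le.2 ht.2) x t ⟨ht.1, (Nat.le_ceil t).trans (by linarith)⟩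
  have hmem : ∀ t : ℝ, 0 ≤ t → t ∈ Icc (0 : ℝ) ((⌈t⌉₊ : ℕ) + 1) := fun t ht =>
    ⟨ht, (Nat.le_ceil t).trans (by linarith)⟩
  refine ⟨u, fun x => ?_, fun x t ht => (hU _ t (hmem t ht)).1 x,
    fun x t ht => (hU _ t (hmem t ht)).2.1 x, fun t ht => (hU _ t (hmem t ht)).2.2.1,
    fun t ht => (hU _ t (hmem t ht)).2.2.2, fun x T hT => ?_, fun x t ht => ?_⟩
  · exact hU0 _ x
  · refine ((hUc ⌈T⌉₊ x).mono (Icc_subset_Icc_right (hmem T hT.le).2)).congr fun t ht => ?_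
    exact hu _ x t ⟨ht.1, ht.2.trans (Nat.le_ceil T)⟩
  · have hlt : t < (⌈t⌉₊ + 1 : ℕ) := by push_cast; linarith [Nat.le_ceil t]
    have h1 := hUe (⌈t⌉₊ + 1) x t ⟨ht, by linarith⟩
    have h2 : (fun y => u y t) = fun y => U (⌈t⌉₊ + 1) y t :=
      funext fun y => hu _ y t ⟨ht.le, hlt.le⟩
    rw [h2]
    refine h1.congr_of_eventuallyEq ?_
    filter_upwards [Ioo_mem_nhds ht hlt] with s hs
    exact hu _ x s ⟨hs.1.le, hs.2.le⟩

theorem abs_le_of_lNorm_le {r δ : ℝ} (hr : 1 ≤ r) (hδ : 0 < δ) (hdeg : ∀ x, δ ≤ G.deg x)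
    {f : V → ℝ} {C : ℝ≥0} (h : G.lNorm r f ≤ C) (x : V) : |f x| ≤ ((C : ℝ) ^ r / δ) ^ r⁻¹ := by
  have hr0 : 0 < r := by linarith
  rw [lNorm, one_div, ENNReal.rpow_inv_le_iff hr0] at h
  have h1 := (ENNReal.le_tsum x).trans h
  rw [← ENNReal.ofReal_coe_nnreal, ENNReal.ofReal_rpow_of_nonneg C.coe_nonneg hr0.le,
    ENNReal.ofReal_le_ofReal_iff (Real.rpow_nonneg C.coe_nonneg _)] at h1
  have h2 : |f x| ^ r ≤ (C : ℝ) ^ r / δ := by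
    rw [le_div_iff₀ hδ]
    exact (mul_le_mul_of_nonneg_left (hdeg x) (Real.rpow_nonneg (abs_nonneg _) _)).trans h1
  calc |f x| = (|f x| ^ r) ^ r⁻¹ := (Real.rpow_rpow_inv (abs_nonneg _) hr0.ne').symm
    _ ≤ _ := Real.rpow_le_rpow (Real.rpow_nonneg (abs_nonneg _) _) h2 (by positivity)

variable {G}

theorem IsSolution.exists_bound {r T δ : ℝ} (hr : 1 ≤ r) (hT : 0 < T) (hδ : 0 < δ)
    (hdeg : ∀ x, δ ≤ G.deg x) {v : V → ℝ → ℝ} (hv : G.IsSolution p r T v) :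
    ∃ B, ∀ x, ∀ t ∈ Icc 0 T, |v x t| ≤ B := by
  obtain ⟨C, hC⟩ := hv.bounded
  refine ⟨((C : ℝ) ^ r / δ) ^ r⁻¹, fun x => ?_⟩
  have hcont : ContinuousOn (fun t => |v x t|) (Icc 0 T) := (hv.contDiff x).continuousOn.abs
  have hae : (fun t => max |v x t| (((C : ℝ) ^ r / δ) ^ r⁻¹))
      =ᵐ[volume.restrict (Icc 0 T)] fun _ => ((C : ℝ) ^ r / δ) ^ r⁻¹ := by
    rw [← restrict_Ioo_eq_restrict_Icc]
    filter_upwards [hC] with t ht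
    exact max_eq_right (G.abs_le_of_lNorm_le hr hδ hdeg ht x)
  have := Measure.eqOn_Icc_of_ae_eq volume hT.ne hae (ContinuousOn.sup hcont continuousOn_const)
    continuousOn_const
  exact fun t ht => max_eq_right_iff.1 (this ht)

theorem IsGlobalFlow.abs_le {R : ℝ} {u₀ : V → ℝ} {u : V → ℝ → ℝ} (hu : G.IsGlobalFlow p R u₀ u)
    (x : V) {t : ℝ} (ht : 0 ≤ t) : |u x t| ≤ R := by
  rw [abs_of_nonneg (hu.nonneg x t ht)]; exact hu.le_bound x t ht

theorem IsGlobalFlow.unique [Infinite V] (hp : 2 < p) {r T δ R : ℝ} (hr : 1 ≤ r) (hT : 0 < T)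
    (hδ : 0 < δ) (hdeg : ∀ x, δ ≤ G.deg x) {u₀ : V → ℝ} {u v : V → ℝ → ℝ}
    (hu : G.IsGlobalFlow p R u₀ u) (hv : G.IsCauchySolution p r T u₀ v) :
    ∀ x, ∀ t ∈ Icc 0 T, v x t = u x t := by
  obtain ⟨B, hB⟩ := hv.toIsSolution.exists_bound hr hT hδ hdeg
  have hvb : ∀ x, ∀ t ∈ Icc 0 T, |v x t| ≤ max B R := fun x t ht =>
    (hB x t ht).trans (le_max_left _ _)
  have hub : ∀ x, ∀ t ∈ Icc 0 T, |u x t| ≤ max B R := fun x t ht =>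
    (hu.abs_le x ht.1).trans (le_max_right _ _)
  have hvc := fun x => (hv.contDiff x).continuousOn
  have huc := fun x => (hu.contDiff x T hT).continuousOn
  have hue : ∀ x, ∀ t ∈ Ioo 0 T, _ := fun x t ht => hu.equation x t ht.1
  intro x t ht
  exact le_antisymm
    (G.le_of_pLaplacian_flow hp hvb hub hvc huc hv.equation hue
      (fun x => by rw [hv.initial, hu.initial]) x t ht)
    (G.le_of_pLaplacian_flow hp hub hvb huc hvc hue hv.equation
      (fun x => by rw [hv.initial, hu.initial]) x t ht)

theorem pLaplacian_mul (hp : 2 < p) {c : ℝ} (hc : 0 ≤ c) (f : V → ℝ) (x : V) :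
    G.pLaplacian p (fun y => c * f y) x = c ^ (p - 1) * G.pLaplacian p f x := by
  have h : ∀ y, |c * f y - c * f x| ^ (p - 2) * (c * f y - c * f x) * G.weight x y =
      c ^ (p - 1) * (|f y - f x| ^ (p - 2) * (f y - f x) * G.weight x y) := fun y => by
    have := pFlux_mul hp hc (f y - f x)
    rw [pFlux, pFlux, mul_sub] at this
    rw [this, mul_assoc]
  rw [pLaplacian, pLaplacian]
  simp only [h, tsum_mul_left]
  ring

/-- The Bénilan–Crandall estimate `u_t ≥ -u / ((p - 2) t)`.  For `l > 1` the rescaled function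
`l^(1/(p-2)) u(x, l t)` is a solution with larger datum, hence lies above `u`; differentiate at
`l = 1`. -/
theorem IsGlobalFlow.neg_pLaplacian_le [Infinite V] (hp : 2 < p) {R : ℝ} {u₀ : V → ℝ}
    {u : V → ℝ → ℝ} (hu : G.IsGlobalFlow p R u₀ u) (x : V) {t : ℝ} (ht : 0 < t) :
    -G.pLaplacian p (fun y => u y t) x ≤ u x t / ((p - 2) * t) := by
  have hp2 : 0 < p - 2 := by linarith
  set b : ℝ := 1 / (p - 2) with hb
  have hb0 : 0 < b := by positivity
  have hcmp : ∀ l : ℝ, 1 < l → u x t ≤ l ^ b * u x (l * t) := by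
    intro l hl
    have hl0 : 0 < l := by linarith
    have hlb : 1 ≤ l ^ b := Real.one_le_rpow hl.le hb0.le
    have hR : 0 ≤ R := (abs_nonneg _).trans (hu.abs_le x ht.le)
    have hmul : ∀ s, HasDerivAt (fun s : ℝ => l * s) l s := fun s => by
      simpa using (hasDerivAt_id s).const_mul l
    refine G.le_of_pLaplacian_flow hp (R := l ^ b * R) (T := t) (u := u)
      (v := fun x s => l ^ b * u x (l * s))
      (fun x s hs => (hu.abs_le x hs.1).trans (le_mul_of_one_le_left hR hlb)) ?_
      (fun x => (hu.contDiff x t ht).continuousOn) ?_ (fun x s hs => hu.equation x s hs.1) ?_ ?_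
      x t ⟨ht.le, le_rfl⟩
    · intro x s hs
      rw [abs_mul, abs_of_nonneg (by linarith : (0 : ℝ) ≤ l ^ b)]
      exact mul_le_mul_of_nonneg_left (hu.abs_le x (mul_nonneg hl0.le hs.1)) (by linarith)
    · intro x
      refine continuousOn_const.mul ((hu.contDiff x (l * t) (by positivity)).continuousOn.comp
        (by fun_prop) fun s hs => ⟨mul_nonneg hl0.le hs.1, mul_le_mul_of_nonneg_left hs.2 hl0.le⟩)
    · intro x s hs
      have h1 := ((hu.equation x (l * s) (mul_pos hl0 hs.1)).comp s (hmul s)).const_mul (l ^ b)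
      rw [pLaplacian_mul hp (by linarith)]
      -- the exponents match: `b (p - 1) = b + 1`
      have hexp : (l ^ b) ^ (p - 1) = l ^ b * l := by
        rw [← Real.rpow_mul hl0.le, show b * (p - 1) = b + 1 by rw [hb]; field_simp; ring,
          Real.rpow_add_one hl0.ne']
      rw [hexp, mul_assoc, mul_comm l]
      exact h1
    · intro x
      simp only [mul_zero]
      exact le_mul_of_one_le_left (hu.nonneg x 0 le_rfl) hlb
  have hd : HasDerivAt (fun l : ℝ => l ^ b * u x (l * t))
      (b * u x t + G.pLaplacian p (fun y => u y t) x * t) 1 := by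
    have h1 : HasDerivAt (fun l : ℝ => l ^ b) b 1 := by
      simpa using Real.hasDerivAt_rpow_const (x := 1) (p := b) (Or.inl one_ne_zero)
    have h2 : HasDerivAt (fun l : ℝ => l * t) t 1 := by
      simpa using (hasDerivAt_id (1 : ℝ)).mul_const t
    have h3 : HasDerivAt (u x) (G.pLaplacian p (fun y => u y t) x) (1 * t) := by
      rw [one_mul]; exact hu.equation x t ht
    have h4 := h1.mul (h3.comp (1 : ℝ) h2)
    simp only [one_mul, Real.one_rpow, Function.comp_apply] at h4
    exact h4
  have hslope := (hasDerivWithinAt_iff_tendsto_slope' (s := Ioi (1 : ℝ)) (by simp)).1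
    hd.hasDerivWithinAt
  have hnn : 0 ≤ b * u x t + G.pLaplacian p (fun y => u y t) x * t := by
    refine ge_of_tendsto hslope ?_
    filter_upwards [self_mem_nhdsWithin] with l hl
    rw [slope_def_field]
    refine div_nonneg ?_ (sub_nonneg.2 (le_of_lt hl))
    simpa using hcmp l hl
  rw [le_div_iff₀ (by positivity)]
  have : (p - 2) * (b * u x t) = u x t := by rw [hb]; field_simp
  nlinarith

end WeightedGraph

/-! ### Scalar inequalities -/

theorem abs_max_sub_rpow_le {p : ℝ} (hp : 2 < p) (a b k : ℝ) :
    |max (b - k) 0 - max (a - k) 0| ^ p ≤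
      pFlux p (b - a) * (max (b - k) 0 - max (a - k) 0) := by
  have key : ∀ a b : ℝ, a ≤ b → |max (b - k) 0 - max (a - k) 0| ^ p ≤
      pFlux p (b - a) * (max (b - k) 0 - max (a - k) 0) := fun a b hab => by
    have h0 : 0 ≤ max (b - k) 0 - max (a - k) 0 :=
      sub_nonneg.2 (max_le_max (by linarith) le_rfl)
    have h1 : max (b - k) 0 - max (a - k) 0 ≤ b - a := by
      have : max (b - k) 0 ≤ max (a - k) 0 + (b - a) :=
        max_le (by linarith [le_max_left (a - k) 0]) (by linarith [le_max_right (a - k) 0])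
      linarith
    rw [abs_of_nonneg h0, pFlux_of_nonneg hp (by linarith)]
    rcases h0.eq_or_lt with h | h
    · rw [← h, Real.zero_rpow (by linarith), mul_zero]
    · calc (max (b - k) 0 - max (a - k) 0) ^ p
          = (max (b - k) 0 - max (a - k) 0) ^ (p - 1) * (max (b - k) 0 - max (a - k) 0) := by
            rw [← Real.rpow_add_one h.ne', sub_add_cancel]
        _ ≤ _ := mul_le_mul_of_nonneg_right (Real.rpow_le_rpow h0 h1 (by linarith)) h0
  rcases le_total a b with h | h
  · exact key a b h
  · have := key b a h
    rw [abs_sub_comm, ← neg_sub b a, pFlux_neg] at this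
    linarith

/-- Fast geometric convergence for a superlinear recursion. -/
theorem le_pow_of_superlinear_recursion {a : ℕ → ℝ} {c B σ : ℝ} (hB : 0 < B) (hσ : 0 < σ)
    (hc : 0 ≤ c) (ha : ∀ n, 0 ≤ a n) (ha0 : a 0 ≤ 1)
    (hrec : ∀ n, a (n + 1) ≤ c * B ^ n * a n ^ (1 + σ)) (hcB : c ≤ (B ^ σ⁻¹)⁻¹) (n : ℕ) :
    a n ≤ ((B ^ σ⁻¹)⁻¹) ^ n := by
  have hq0 : 0 < (B ^ σ⁻¹)⁻¹ := inv_pos.2 (Real.rpow_pos_of_pos hB _)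
  have hqσ : ((B ^ σ⁻¹)⁻¹) ^ σ = B⁻¹ := by
    rw [Real.inv_rpow (Real.rpow_nonneg hB.le _), Real.rpow_inv_rpow hB.le hσ.ne']
  generalize (B ^ σ⁻¹)⁻¹ = q at hq0 hqσ hcB ⊢
  induction n with
  | zero => simpa using ha0
  | succ n ih =>
    have hqn : 0 < q ^ n := pow_pos hq0 n
    have h1 : a n ^ (1 + σ) ≤ q ^ n * (B⁻¹) ^ n := by
      refine (Real.rpow_le_rpow (ha n) ih (by linarith)).trans (le_of_eq ?_)
      rw [Real.rpow_add hqn, Real.rpow_one, ← hqσ, ← Real.rpow_natCast, ← Real.rpow_natCast,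
        ← Real.rpow_mul hq0.le, ← Real.rpow_mul hq0.le, mul_comm (n : ℝ) σ]
    calc a (n + 1) ≤ c * B ^ n * (q ^ n * (B⁻¹) ^ n) :=
          (hrec n).trans (mul_le_mul_of_nonneg_left h1 (by positivity))
      _ = c * q ^ n * (B * B⁻¹) ^ n := by rw [mul_pow]; ring
      _ = c * q ^ n := by rw [mul_inv_cancel₀ hB.ne', one_pow, mul_one]
      _ ≤ q * q ^ n := mul_le_mul_of_nonneg_right hcB hqn.le
      _ = q ^ (n + 1) := by rw [pow_succ, mul_comm]

namespace WeightedGraph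

variable {V : Type*} (G : WeightedGraph V) {p N : ℝ} {Λ : ℝ → ℝ}

/-! ### The sup bound for functions with `-Δ_p f ≤ A f` -/

/-- The hypotheses under which the elliptic estimates hold: `f` is nonnegative, bounded by `R`,
of class `ℓ¹(V)`, and satisfies `-Δ_p f ≤ A f`. -/
structure IsSubEigen (p A R : ℝ) (f : V → ℝ) : Prop where
  nonneg : ∀ x, 0 ≤ f x
  le_bound : ∀ x, f x ≤ R
  summable : Summable fun x => f x * G.deg x
  neg_le : ∀ x, -G.pLaplacian p f x ≤ A * f x

variable {G}

theorem IsSubEigen.abs_sub_le {A R : ℝ} {f : V → ℝ} (hf : G.IsSubEigen p A R f) (x y : V) :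
    |f y - f x| ≤ R :=
  abs_le.2 ⟨by linarith [hf.nonneg y, hf.le_bound x], by linarith [hf.nonneg x, hf.le_bound y]⟩

theorem IsSubEigen.summable_abs {A R : ℝ} {f : V → ℝ} (hf : G.IsSubEigen p A R f) :
    Summable fun x => |f x| * G.deg x :=
  hf.summable.congr fun x => by rw [abs_of_nonneg (hf.nonneg x)]

/-- The inequality `-Δ_p f ≤ A f` tested with a bounded nonnegative function. -/
theorem IsSubEigen.tsum_pFlux_le [Infinite V] (hp : 2 < p) {A R B : ℝ} {f : V → ℝ}
    (hf : G.IsSubEigen p A R f) {g : V → ℝ} (hg : ∀ x, 0 ≤ g x) (hgB : ∀ x, g x ≤ B) :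
    (Summable fun z : V × V => pFlux p (f z.2 - f z.1) * (g z.2 - g z.1) * G.weight z.1 z.2) ∧
    (Summable fun x => f x * g x * G.deg x) ∧
    ∑' z : V × V, pFlux p (f z.2 - f z.1) * (g z.2 - g z.1) * G.weight z.1 z.2 ≤
      2 * A * ∑' x, f x * g x * G.deg x := by
  obtain ⟨o⟩ : Nonempty V := inferInstance
  have hR : 0 ≤ R := (hf.nonneg o).trans (hf.le_bound o)
  obtain ⟨h1, h2, h3⟩ := tsum_mul_tsum_eq_of_antisymm
    (G.summable_truncFlux_prod hp hR hf.summable_abs) (fun x y => by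
      rw [G.weight_symm y x, ← neg_sub (f y) (f x), truncFlux_neg hR, neg_mul])
    (g := g) (B := B) (fun x => by rw [abs_of_nonneg (hg x)]; exact hgB x)
  have heq : ∀ z : V × V, truncFlux p R (f z.2 - f z.1) * G.weight z.1 z.2 * (g z.2 - g z.1) =
      pFlux p (f z.2 - f z.1) * (g z.2 - g z.1) * G.weight z.1 z.2 := fun z => by
    rw [truncFlux_eq (hf.abs_sub_le _ _)]; ring
  simp only [heq] at h2 h3
  have hfg : Summable fun x => f x * g x * G.deg x := by
    refine Summable.of_nonneg_of_le
      (fun x => mul_nonneg (mul_nonneg (hf.nonneg x) (hg x)) (G.deg_nonneg x)) (fun x => ?_)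
      (hf.summable.mul_left B)
    calc f x * g x * G.deg x = g x * (f x * G.deg x) := by ring
      _ ≤ _ := mul_le_mul_of_nonneg_right (hgB x) (mul_nonneg (hf.nonneg x) (G.deg_nonneg x))
  refine ⟨h2, hfg, ?_⟩
  have h4 : -∑' x, g x * G.truncLap p R f x ≤ A * ∑' x, f x * g x * G.deg x := by
    rw [← tsum_neg, ← tsum_mul_left]
    refine h1.neg.tsum_le_tsum (fun x => ?_) (hfg.mul_left A)
    have h5 := mul_le_mul_of_nonneg_left (hf.neg_le x) (mul_nonneg (hg x) (G.deg_nonneg x))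
    have h6 : G.deg x * G.pLaplacian p f x = G.truncLap p R f x := by
      rw [G.pLaplacian_eq hf.abs_sub_le, mul_div_cancel₀ _ (G.deg_pos x).ne']
    change -(g x * G.truncLap p R f x) ≤ _
    rw [← h6]
    linarith
  have h7 : ∑' x, g x * G.truncLap p R f x =
      -(1 / 2) * ∑' z : V × V, pFlux p (f z.2 - f z.1) * (g z.2 - g z.1) * G.weight z.1 z.2 := h3
  rw [h7] at h4
  linarith

/-- One step of De Giorgi's iteration, comparing the volumes of two superlevel sets. -/
theorem IsSubEigen.level_step [Infinite V] (hp : 2 < p) (hFK : G.FaberKrahn p Λ)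
    (hΛ : ∀ v, 0 < v → 0 < Λ v) {A R h k : ℝ} {f : V → ℝ}
    (hf : G.IsSubEigen p A R f) (hA : 0 ≤ A) (hh : 0 ≤ h) (hhk : h < k)
    {U W : Finset V} (hU : ∀ x, x ∈ U ↔ h < f x) (hW : ∀ x, x ∈ W ↔ k < f x)
    (hUpos : 0 < G.vol U) :
    Λ (G.vol U) * ((k - h) ^ p * G.vol W) ≤ 2 * A * (R * R * G.vol U) := by
  set w : V → ℝ := fun x => max (f x - h) 0 with hw
  have hw0 : ∀ x, 0 ≤ w x := fun x => le_max_right _ _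
  have hwf : ∀ x, w x ≤ f x := fun x => max_le (by linarith) (hf.nonneg x)
  have hwR : ∀ x, w x ≤ R := fun x => (hwf x).trans (hf.le_bound x)
  have hwU : ∀ x, x ∉ U → w x = 0 := fun x hx => by
    rw [hU, not_lt] at hx
    exact max_eq_right (by linarith)
  have hws : Summable fun x => |w x| * G.deg x :=
    summable_of_ne_finset_zero (s := U) fun x hx => by rw [hwU x hx, abs_zero, zero_mul]
  have hwp := G.summable_abs_sub_rpow (q := p) (by linarith)
    (fun x => (abs_of_nonneg (hw0 x)).trans_le (hwR x)) hws
  have h1 := hFK.le_tsum hUpos hwU hwp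
  obtain ⟨h2, -, h3⟩ := hf.tsum_pFlux_le hp hw0 hwR
  have h4 : ∑' z : V × V, |w z.2 - w z.1| ^ p * G.weight z.1 z.2 ≤
      ∑' z : V × V, pFlux p (f z.2 - f z.1) * (w z.2 - w z.1) * G.weight z.1 z.2 :=
    hwp.tsum_le_tsum (fun z => mul_le_mul_of_nonneg_right (abs_max_sub_rpow_le hp _ _ _)
      (G.weight_nonneg _ _)) h2
  have h5 : ∑' x, f x * w x * G.deg x ≤ R * R * G.vol U := by
    rw [tsum_eq_sum (s := U) fun x hx => by rw [hwU x hx, mul_zero, zero_mul], vol,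
      Finset.mul_sum]
    refine Finset.sum_le_sum fun x _ => mul_le_mul_of_nonneg_right ?_ (G.deg_nonneg x)
    exact mul_le_mul (hf.le_bound x) (hwR x) (hw0 x) ((hf.nonneg x).trans (hf.le_bound x))
  have hWU : W ⊆ U := fun x hx => (hU x).2 (hhk.trans ((hW x).1 hx))
  have h6 : (k - h) ^ p * G.vol W ≤ ∑ x ∈ U, |w x| ^ p * G.deg x := by
    rw [vol, Finset.mul_sum]
    refine le_trans (Finset.sum_le_sum fun x hx => ?_)
      (Finset.sum_le_sum_of_subset_of_nonneg hWU fun x _ _ =>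
        mul_nonneg (Real.rpow_nonneg (abs_nonneg _) _) (G.deg_nonneg x))
    refine mul_le_mul_of_nonneg_right (Real.rpow_le_rpow (by linarith) ?_ (by linarith))
      (G.deg_nonneg x)
    rw [abs_of_nonneg (hw0 x)]
    exact le_max_of_le_left (by linarith [(hW x).1 hx])
  calc _ ≤ Λ (G.vol U) * ∑ x ∈ U, |w x| ^ p * G.deg x :=
        mul_le_mul_of_nonneg_left h6 (hΛ _ hUpos).le
    _ ≤ _ := h1.trans (h4.trans (h3.trans (mul_le_mul_of_nonneg_left h5 (by linarith))))

theorem finite_superlevel {δ : ℝ} (hδ : 0 < δ) (hdeg : ∀ x, δ ≤ G.deg x) {f : V → ℝ}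
    (hf : ∀ x, 0 ≤ f x) (hs : Summable fun x => f x * G.deg x) {h : ℝ} (hh : 0 < h) :
    {x | h < f x}.Finite := by
  have h1 : ∀ᶠ x in Filter.cofinite, f x * G.deg x < h * δ :=
    hs.tendsto_cofinite_zero.eventually_lt_const (by positivity)
  refine (Filter.eventually_cofinite.1 h1).subset fun x hx => ?_
  rw [mem_ofPred_eq, not_lt]
  exact mul_le_mul (le_of_lt hx) (hdeg x) hδ.le (hf x)

/-- De Giorgi's iteration over the levels `H (1 - 2^(-n-1))` below the maximum `H`: were the ratio
in the conclusion smaller, the volumes of the superlevel sets would tend to `0`, whereas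
each of them contains a maximum point. -/
theorem IsSubEigen.max_estimate [Infinite V] (hp : 2 < p) (hN : 0 < N) {κ δ A H : ℝ}
    (hΛ : FaberKrahnFunction p N κ Λ) (hFK : G.FaberKrahn p Λ) (hδ : 0 < δ)
    (hdeg : ∀ x, δ ≤ G.deg x) (hA : 0 ≤ A) (hH : 0 < H) {f : V → ℝ} (hf : G.IsSubEigen p A H f)
    {x₀ : V} (hx₀ : f x₀ = H) :
    H ^ (p - 2) * Λ (2 * (∑' x, f x * G.deg x) / H) ≤
      2 * ((2 : ℝ) ^ p) ^ 2 * ((2 : ℝ) ^ p) ^ (p / N)⁻¹ * A := by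
  set M := ∑' x, f x * G.deg x with hMdef
  set B : ℝ := (2 : ℝ) ^ p with hB
  have hB1 : 1 < B := Real.one_lt_rpow (by norm_num) (by linarith)
  have hB0 : 0 < B := by linarith
  have hσ : 0 < p / N := div_pos (by linarith) hN
  have hMpos : 0 < M :=
    hf.summable.tsum_pos (fun x => mul_nonneg (hf.nonneg x) (G.deg_nonneg x)) x₀
      (by rw [hx₀]; exact mul_pos hH (G.deg_pos x₀))
  set v : ℝ := 2 * M / H with hv
  have hv0 : 0 < v := by positivity
  have hΛv := hΛ.pos v hv0
  set k : ℕ → ℝ := fun n => H * (1 - (1 / 2) ^ (n + 1)) with hk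
  have hpow : ∀ n : ℕ, (1 / 2 : ℝ) ^ (n + 1) ≤ 1 / 2 := fun n => by
    rw [pow_succ]
    exact mul_le_of_le_one_left (by norm_num) (pow_le_one₀ (by norm_num) (by norm_num))
  have hkhalf : ∀ n, H / 2 ≤ k n := fun n => by
    simp only [hk]; nlinarith [hpow n]
  have hkH : ∀ n, k n < H := fun n => by
    have : (0 : ℝ) < (1 / 2) ^ (n + 1) := by positivity
    simp only [hk]; nlinarith
  have hkk : ∀ n, k (n + 1) - k n = H * (1 / 2) ^ (n + 2) := fun n => by
    simp only [hk]; ring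
  have hfin : ∀ n, {x | k n < f x}.Finite := fun n =>
    finite_superlevel hδ hdeg hf.nonneg hf.summable (by linarith [hkhalf n])
  set U : ℕ → Finset V := fun n => (hfin n).toFinset with hUdef
  have hU : ∀ n x, x ∈ U n ↔ k n < f x := fun n x => by simp [hUdef]
  have hUlow : ∀ n, G.deg x₀ ≤ G.vol (U n) := fun n =>
    Finset.single_le_sum (f := G.deg) (fun x _ => G.deg_nonneg x)
      ((hU n x₀).2 (by rw [hx₀]; exact hkH n))
  have hUpos : ∀ n, 0 < G.vol (U n) := fun n => (G.deg_pos x₀).trans_le (hUlow n)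
  -- Chebyshev's inequality at levels above `H / 2`
  have hUv : ∀ n, G.vol (U n) ≤ v := fun n => by
    rw [hv, le_div_iff₀ hH, vol, Finset.sum_mul]
    have h1 : ∑ x ∈ U n, f x * G.deg x ≤ M :=
      hf.summable.sum_le_tsum _ fun x _ => mul_nonneg (hf.nonneg x) (G.deg_nonneg x)
    refine le_trans ?_ (mul_le_mul_of_nonneg_left h1 zero_le_two)
    rw [Finset.mul_sum]
    refine Finset.sum_le_sum fun x hx => ?_
    have h2 : H / 2 ≤ f x := (hkhalf n).trans ((hU n x).1 hx).le
    nlinarith [G.deg_nonneg x]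
  set c : ℝ := 2 * A * H ^ 2 * (H ^ p)⁻¹ * B ^ 2 * (Λ v)⁻¹ with hc
  have hHp : 0 < H ^ p := Real.rpow_pos_of_pos hH _
  have hc0 : 0 ≤ c := by positivity
  set a : ℕ → ℝ := fun n => G.vol (U n) / v with ha
  have hrec : ∀ n, a (n + 1) ≤ c * B ^ n * a n ^ (1 + p / N) := by
    intro n
    have h1 := hf.level_step hp hFK hΛ.pos hA (by linarith [hkhalf n] : 0 ≤ k n)
      (sub_pos.1 (by rw [hkk]; positivity)) (hU n) (hU (n + 1)) (hUpos n)
    have hΛn := hΛ.pos _ (hUpos n)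
    have h2 : (Λ (G.vol (U n)))⁻¹ ≤ (Λ v)⁻¹ * a n ^ (p / N) := by
      have h3 : (Λ (G.vol (U n)))⁻¹ * G.vol (U n) ^ (-(p / N)) ≤ (Λ v)⁻¹ * v ^ (-(p / N)) :=
        hΛ.lower_growth (hUpos n) hv0 (hUv n)
      have h4 : 0 < G.vol (U n) ^ (p / N) := Real.rpow_pos_of_pos (hUpos n) _
      rw [Real.rpow_neg (hUpos n).le, Real.rpow_neg hv0.le, ← div_eq_mul_inv,
        div_le_iff₀ h4] at h3
      refine h3.trans (le_of_eq ?_)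
      simp only [ha]
      rw [Real.div_rpow (hUpos n).le hv0.le]
      ring
    have h5 : (k (n + 1) - k n) ^ p = H ^ p * (B ^ (n + 2))⁻¹ := by
      rw [hkk, Real.mul_rpow hH.le (by positivity), ← Real.rpow_natCast (1 / 2 : ℝ),
        ← Real.rpow_mul (by norm_num), mul_comm _ p, Real.rpow_mul (by norm_num),
        Real.rpow_natCast, one_div, Real.inv_rpow (by norm_num), inv_pow]
    rw [h5] at h1
    have hBn : 0 < B ^ (n + 2) := by positivity
    have h6 : G.vol (U (n + 1)) ≤
        2 * A * H ^ 2 * (H ^ p)⁻¹ * B ^ (n + 2) * ((Λ (G.vol (U n)))⁻¹ * G.vol (U n)) := by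
      have h7 : G.vol (U (n + 1)) = (Λ (G.vol (U n)))⁻¹ * (H ^ p)⁻¹ * B ^ (n + 2) *
          (Λ (G.vol (U n)) * (H ^ p * (B ^ (n + 2))⁻¹ * G.vol (U (n + 1)))) := by
        field_simp
      rw [h7]
      refine (mul_le_mul_of_nonneg_left h1 (by positivity)).trans (le_of_eq ?_)
      ring
    have han : 0 < a n := div_pos (hUpos n) hv0
    have h8 : G.vol (U n) = a n * v := (div_mul_cancel₀ _ hv0.ne').symm
    simp only [ha]
    rw [div_le_iff₀ hv0]
    refine h6.trans ?_
    calc _ ≤ 2 * A * H ^ 2 * (H ^ p)⁻¹ * B ^ (n + 2) *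
          ((Λ v)⁻¹ * a n ^ (p / N) * G.vol (U n)) :=
          mul_le_mul_of_nonneg_left (mul_le_mul_of_nonneg_right h2 (hUpos n).le) (by positivity)
      _ = _ := by
        change _ = c * B ^ n * a n ^ (1 + p / N) * v
        rw [h8, Real.rpow_add han, Real.rpow_one, hc, pow_add]
        ring
  have hlt : (B ^ (p / N)⁻¹)⁻¹ < c := by
    by_contra hcon
    have h1 := fun n => le_pow_of_superlinear_recursion hB0 hσ hc0
      (fun n => (div_pos (hUpos n) hv0).le) ((div_le_one hv0).2 (hUv 0)) hrec (not_lt.1 hcon) n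
    have hq1 : (B ^ (p / N)⁻¹)⁻¹ < 1 := inv_lt_one_of_one_lt₀ (Real.one_lt_rpow hB1 (by positivity))
    have h2 := tendsto_pow_atTop_nhds_zero_of_lt_one
      (inv_nonneg.2 (Real.rpow_nonneg hB0.le (p / N)⁻¹)) hq1
    have h3 : G.deg x₀ / v ≤ 0 := ge_of_tendsto' h2 fun n =>
      (div_le_div_of_nonneg_right (hUlow n) hv0.le).trans (h1 n)
    exact absurd h3 (not_le.2 (div_pos (G.deg_pos x₀) hv0))
  have hq : 0 < B ^ (p / N)⁻¹ := Real.rpow_pos_of_pos hB0 _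
  have hHsplit : H ^ p = H ^ (p - 2) * H ^ 2 := by
    rw [← Real.rpow_natCast, ← Real.rpow_add hH]; norm_num
  have hH2 : 0 < H ^ (p - 2) := Real.rpow_pos_of_pos hH _
  have h9 : H ^ (p - 2) * Λ v = H ^ (p - 2) * Λ v * B ^ (p / N)⁻¹ * (B ^ (p / N)⁻¹)⁻¹ := by
    field_simp
  rw [h9]
  refine (mul_le_mul_of_nonneg_left hlt.le (by positivity)).trans (le_of_eq ?_)
  rw [hc, hHsplit]
  field_simp

theorem exists_max {δ : ℝ} (hδ : 0 < δ) (hdeg : ∀ x, δ ≤ G.deg x) {f : V → ℝ}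
    (hf : ∀ x, 0 ≤ f x) (hs : Summable fun x => f x * G.deg x) {o : V} (ho : 0 < f o) :
    ∃ x₀, ∀ x, f x ≤ f x₀ := by
  have hfin := finite_superlevel hδ hdeg hf hs (h := f o / 2) (by linarith)
  obtain ⟨x₀, h1, h2⟩ := hfin.toFinset.exists_max_image f ⟨o, by simpa using ho⟩
  refine ⟨x₀, fun x => ?_⟩
  by_cases hx : f o / 2 < f x
  · exact h2 x (by simpa using hx)
  · have : f o / 2 < f x₀ := by simpa using h1
    linarith

end WeightedGraph

/-! ### The function `ψ` -/

theorem psiInv_spec {p N κ : ℝ} {Λ : ℝ → ℝ} (hp : 2 < p) (hN : 0 < N)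
    (hΛ : FaberKrahnFunction p N κ Λ) {y : ℝ} (hy : 0 < y) :
    0 < psiInv p 1 Λ y ∧ psi p 1 Λ (psiInv p 1 Λ y) = y := by
  have h : ∃ a ∈ Ioi (0 : ℝ), psi p 1 Λ a = y := (psi_bijOn hp le_rfl hN hΛ).surjOn hy
  exact ⟨Function.invFunOn_mem h, Function.invFunOn_eq h⟩

/-- `ψ` grows at least like the power `p - 2`, because `Λ` is decreasing. -/
theorem le_of_psi_le {p N κ : ℝ} {Λ : ℝ → ℝ} (hp : 2 < p) (hΛ : FaberKrahnFunction p N κ Λ)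
    {s t C : ℝ} (hs : 0 < s) (ht : 0 < t) (hC : 1 ≤ C) (h : psi p 1 Λ s ≤ C * psi p 1 Λ t) :
    s ≤ C ^ (p - 2)⁻¹ * t := by
  have hp2 : 0 < p - 2 := by linarith
  rcases le_total s t with hst | hst
  · exact hst.trans (le_mul_of_one_le_left ht.le (Real.one_le_rpow hC (by positivity)))
  rw [psi, psi, div_one] at h
  have hΛt := hΛ.pos _ (inv_pos.2 ht)
  have h1 : Λ t⁻¹ ≤ Λ s⁻¹ :=
    hΛ.antitoneOn (inv_pos.2 hs : 0 < s⁻¹) (inv_pos.2 ht : 0 < t⁻¹) (inv_anti₀ ht hst)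
  have h2 : s ^ (p - 2) ≤ C * t ^ (p - 2) := by
    refine le_of_mul_le_mul_right ?_ hΛt
    calc _ ≤ s ^ (p - 2) * Λ s⁻¹ := mul_le_mul_of_nonneg_left h1 (Real.rpow_nonneg hs.le _)
      _ ≤ _ := by rw [mul_assoc]; exact h
  calc s = (s ^ (p - 2)) ^ (p - 2)⁻¹ := (Real.rpow_rpow_inv hs.le hp2.ne').symm
    _ ≤ (C * t ^ (p - 2)) ^ (p - 2)⁻¹ :=
      Real.rpow_le_rpow (Real.rpow_nonneg hs.le _) h2 (by positivity)
    _ = _ := by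
      rw [Real.mul_rpow (by linarith) (Real.rpow_nonneg ht.le _), Real.rpow_rpow_inv ht.le hp2.ne']

/-- `ψ` grows at least like the power `p - 2 + p / N`, by the lower growth bound on `1 / Λ`. -/
theorem le_of_psi_le_of_lower_growth {p N κ : ℝ} {Λ : ℝ → ℝ} (hp : 2 < p) (hN : 0 < N)
    (hΛ : FaberKrahnFunction p N κ Λ)
    {s t C : ℝ} (hs : 0 < s) (ht : 0 < t) (hC : 1 ≤ C) (h : psi p 1 Λ s ≤ C * psi p 1 Λ t) :
    s ≤ C ^ (p - 2 + p / N)⁻¹ * t := by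
  have hpN : 0 < p / N := div_pos (by linarith) hN
  have he : 0 < p - 2 + p / N := by linarith
  rcases le_total s t with hst | hst
  · exact hst.trans (le_mul_of_one_le_left ht.le (Real.one_le_rpow hC (by positivity)))
  rw [psi, psi, div_one] at h
  have hΛt := hΛ.pos _ (inv_pos.2 ht)
  have hΛs := hΛ.pos _ (inv_pos.2 hs)
  have hsp : 0 < s ^ (p / N) := Real.rpow_pos_of_pos hs _
  have htp : 0 < t ^ (p / N) := Real.rpow_pos_of_pos ht _
  have h1 : (Λ s⁻¹)⁻¹ * s ^ (p / N) ≤ (Λ t⁻¹)⁻¹ * t ^ (p / N) := by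
    have := hΛ.lower_growth (inv_pos.2 hs : 0 < s⁻¹) (inv_pos.2 ht : 0 < t⁻¹) (inv_anti₀ ht hst)
    simpa only [Real.inv_rpow hs.le, Real.inv_rpow ht.le, Real.rpow_neg hs.le,
      Real.rpow_neg ht.le, inv_inv] using this
  have h2 : Λ t⁻¹ * s ^ (p / N) ≤ Λ s⁻¹ * t ^ (p / N) := by
    have := mul_le_mul_of_nonneg_left h1 (mul_pos hΛs hΛt).le
    calc _ = Λ s⁻¹ * Λ t⁻¹ * ((Λ s⁻¹)⁻¹ * s ^ (p / N)) := by
          rw [mul_comm (Λ s⁻¹), mul_assoc, mul_inv_cancel_left₀ hΛs.ne']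
      _ ≤ _ := this
      _ = _ := by rw [mul_assoc, mul_inv_cancel_left₀ hΛt.ne']
  have h3 : s ^ (p - 2 + p / N) ≤ C * t ^ (p - 2 + p / N) := by
    refine le_of_mul_le_mul_right ?_ hΛt
    rw [Real.rpow_add hs, Real.rpow_add ht]
    calc _ = s ^ (p - 2) * (Λ t⁻¹ * s ^ (p / N)) := by ring
      _ ≤ s ^ (p - 2) * (Λ s⁻¹ * t ^ (p / N)) :=
        mul_le_mul_of_nonneg_left h2 (Real.rpow_nonneg hs.le _)
      _ = s ^ (p - 2) * Λ s⁻¹ * t ^ (p / N) := by ring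
      _ ≤ C * (t ^ (p - 2) * Λ t⁻¹) * t ^ (p / N) := mul_le_mul_of_nonneg_right h htp.le
      _ = _ := by ring
  calc s = (s ^ (p - 2 + p / N)) ^ (p - 2 + p / N)⁻¹ := (Real.rpow_rpow_inv hs.le he.ne').symm
    _ ≤ (C * t ^ (p - 2 + p / N)) ^ (p - 2 + p / N)⁻¹ :=
      Real.rpow_le_rpow (Real.rpow_nonneg hs.le _) h3 (by positivity)
    _ = _ := by
      rw [Real.mul_rpow (by linarith) (Real.rpow_nonneg ht.le _), Real.rpow_rpow_inv ht.le he.ne']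

/-! ### The gradient bound for functions with `-Δ_p f ≤ A f` -/

/-- Either the first or the second term on the right suffices, according to whether
`ε |b - a|` exceeds `max(a, b)^(1/(p-1))`.  The exponent `θ = (p-2)/(p-1)` is the one for which the
second term is linear in `a + b`, hence summable against the weight. -/
theorem abs_sub_rpow_le_flux_add {p θ ε a b : ℝ} (hp : 2 < p) (hθ : θ = (p - 2) / (p - 1))
    (hε : 0 < ε) (ha : 0 ≤ a) (hb : 0 ≤ b) :
    |b - a| ^ (p - 1) ≤
      ε * θ⁻¹ * (pFlux p (b - a) * (b ^ θ - a ^ θ)) + ε ^ (-(p - 1)) * (a + b) := by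
  have hp1 : 0 < p - 1 := by linarith
  have hθ0 : 0 < θ := by rw [hθ]; exact div_pos (by linarith) hp1
  have hθ1 : θ ≤ 1 := by rw [hθ, div_le_one hp1]; linarith
  have key : ∀ a b : ℝ, 0 ≤ a → a ≤ b → |b - a| ^ (p - 1) ≤
      ε * θ⁻¹ * (pFlux p (b - a) * (b ^ θ - a ^ θ)) + ε ^ (-(p - 1)) * (a + b) := by
    intro a b ha hab
    have hX : 0 ≤ pFlux p (b - a) * (b ^ θ - a ^ θ) := by
      rw [pFlux_of_nonneg hp (by linarith)]
      exact mul_nonneg (Real.rpow_nonneg (by linarith) _)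
        (sub_nonneg.2 (Real.rpow_le_rpow ha hab hθ0.le))
    have hE : 0 < ε ^ (-(p - 1)) := Real.rpow_pos_of_pos hε _
    rcases hab.eq_or_lt with rfl | hlt
    · rw [sub_self, abs_zero, Real.zero_rpow hp1.ne', pFlux_zero]
      simp only [zero_mul, mul_zero, zero_add]
      exact mul_nonneg hE.le (by linarith)
    have hb : 0 < b := ha.trans_lt hlt
    have hD : 0 < b - a := sub_pos.2 hlt
    rw [abs_of_pos hD]
    rcases le_total (b ^ (p - 1)⁻¹) ((b - a) * ε) with h | h
    · have h1 : θ * (b ^ (-(p - 1)⁻¹) * (b - a)) ≤ b ^ θ - a ^ θ := by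
        have h2 := rpow_one_add_le_one_add_mul_self (s := a / b - 1) (p := θ)
          (by linarith [div_nonneg ha hb.le]) hθ0.le hθ1
        rw [add_sub_cancel, Real.div_rpow ha hb.le, div_le_iff₀ (Real.rpow_pos_of_pos hb _)] at h2
        have h3 : b ^ θ = b ^ (-(p - 1)⁻¹) * b := by
          rw [← Real.rpow_add_one hb.ne']
          congr 1
          rw [hθ]; field_simp; ring
        have h4 : (1 + θ * (a / b - 1)) * b ^ θ =
            b ^ θ - θ * (b ^ (-(p - 1)⁻¹) * (b - a)) := by
          have h5 : θ * (a / b - 1) * (b ^ (-(p - 1)⁻¹) * b) =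
              -(θ * (b ^ (-(p - 1)⁻¹) * (b - a))) := by
            field_simp
            ring
          rw [add_mul, one_mul]
          nth_rw 2 [h3]
          rw [h5]; ring
        linarith
      have h2 : 1 ≤ ε * (b ^ (-(p - 1)⁻¹) * (b - a)) := by
        rw [Real.rpow_neg hb.le]
        have hpos : 0 < b ^ (p - 1)⁻¹ := Real.rpow_pos_of_pos hb _
        rw [show ε * ((b ^ (p - 1)⁻¹)⁻¹ * (b - a)) = (b - a) * ε / b ^ (p - 1)⁻¹ by
          field_simp, one_le_div hpos]
        exact h
      have h3 : 1 ≤ ε * θ⁻¹ * (b ^ θ - a ^ θ) := by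
        refine h2.trans ?_
        rw [mul_assoc]
        refine mul_le_mul_of_nonneg_left ?_ hε.le
        rwa [le_inv_mul_iff₀ hθ0]
      have h4 : (b - a) ^ (p - 1) ≤ ε * θ⁻¹ * (pFlux p (b - a) * (b ^ θ - a ^ θ)) := by
        rw [pFlux_of_nonneg hp hD.le]
        calc (b - a) ^ (p - 1) ≤ (b - a) ^ (p - 1) * (ε * θ⁻¹ * (b ^ θ - a ^ θ)) :=
              le_mul_of_one_le_right (Real.rpow_nonneg hD.le _) h3
          _ = _ := by ring
      have : 0 ≤ ε ^ (-(p - 1)) * (a + b) := mul_nonneg hE.le (by linarith)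
      linarith
    · have h1 : (b - a) ^ (p - 1) ≤ ε ^ (-(p - 1)) * b := by
        have h2 := Real.rpow_le_rpow (by positivity) h hp1.le
        rw [Real.mul_rpow hD.le hε.le, Real.rpow_inv_rpow hb.le hp1.ne'] at h2
        rw [Real.rpow_neg hε.le, inv_mul_eq_div, le_div_iff₀ (Real.rpow_pos_of_pos hε _)]
        exact h2
      have h3 : 0 ≤ ε ^ (-(p - 1)) * a := mul_nonneg hE.le ha
      have h4 : 0 ≤ ε * θ⁻¹ * (pFlux p (b - a) * (b ^ θ - a ^ θ)) :=
        mul_nonneg (by positivity) hX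
      rw [mul_add]
      linarith
  rcases le_total a b with h | h
  · exact key a b ha h
  · have := key b a hb h
    rw [abs_sub_comm, ← neg_sub b a, pFlux_neg] at this
    linarith

namespace WeightedGraph

variable {V : Type*} {G : WeightedGraph V} {p N : ℝ} {Λ : ℝ → ℝ}

theorem IsSubEigen.tsum_abs_sub_rpow_le [Infinite V] (hp : 2 < p) {A R θ ε : ℝ}
    (hA : 0 ≤ A) (hθ : θ = (p - 2) / (p - 1)) (hε : 0 < ε) {f : V → ℝ}
    (hf : G.IsSubEigen p A R f) :
    ∑' x, ∑' y, ENNReal.ofReal (|f y - f x| ^ (p - 1) * G.weight x y) ≤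
      ENNReal.ofReal (2 * (ε * θ⁻¹ * A * R ^ θ + ε ^ (-(p - 1))) * ∑' x, f x * G.deg x) := by
  obtain ⟨o⟩ : Nonempty V := inferInstance
  have hp1 : 0 < p - 1 := by linarith
  have hθ0 : 0 < θ := by rw [hθ]; exact div_pos (by linarith) hp1
  have hfabs : ∀ x, |f x| = f x := fun x => abs_of_nonneg (hf.nonneg x)
  have hs := G.summable_abs_sub_rpow (q := p - 1) (by linarith)
    (fun x => (hfabs x).trans_le (hf.le_bound x)) hf.summable_abs
  rw [← ENNReal.tsum_prod (f := fun x y => ENNReal.ofReal (|f y - f x| ^ (p - 1) * G.weight x y)),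
    ← ENNReal.ofReal_tsum_of_nonneg
      (fun z : V × V => mul_nonneg (Real.rpow_nonneg (abs_nonneg _) _) (G.weight_nonneg _ _)) hs]
  refine ENNReal.ofReal_le_ofReal ?_
  obtain ⟨h1, h2, h3⟩ := hf.tsum_pFlux_le hp (g := fun x => f x ^ θ) (B := R ^ θ)
    (fun x => Real.rpow_nonneg (hf.nonneg x) _)
    (fun x => Real.rpow_le_rpow (hf.nonneg x) (hf.le_bound x) hθ0.le)
  have h4 : Summable fun z : V × V => |f z.1| * G.weight z.1 z.2 + |f z.2| * G.weight z.1 z.2 :=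
    (G.summable_fst hf.summable_abs).add (G.summable_snd hf.summable_abs)
  have h5 : ∑' x, f x * f x ^ θ * G.deg x ≤ R ^ θ * ∑' x, f x * G.deg x := by
    rw [← tsum_mul_left]
    refine h2.tsum_le_tsum (fun x => ?_) (hf.summable.mul_left _)
    have := mul_le_mul_of_nonneg_right
      (Real.rpow_le_rpow (hf.nonneg x) (hf.le_bound x) hθ0.le)
      (mul_nonneg (hf.nonneg x) (G.deg_nonneg x))
    linarith
  have h6 : ∑' z : V × V, (|f z.1| * G.weight z.1 z.2 + |f z.2| * G.weight z.1 z.2) =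
      2 * ∑' x, f x * G.deg x := by
    rw [(G.summable_fst hf.summable_abs).tsum_add (G.summable_snd hf.summable_abs),
      G.tsum_fst hf.summable_abs, G.tsum_snd hf.summable_abs]
    simp only [hfabs]
    ring
  have hle := hs.tsum_le_tsum (fun z => ?_) ((h1.mul_left (ε * θ⁻¹)).add
    (h4.mul_left (ε ^ (-(p - 1)))))
  · refine hle.trans ?_
    rw [(h1.mul_left _).tsum_add (h4.mul_left _), tsum_mul_left, tsum_mul_left, h6]
    have h7 := mul_le_mul_of_nonneg_left
      (h3.trans (mul_le_mul_of_nonneg_left h5 (by linarith)))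
      (by positivity : (0 : ℝ) ≤ ε * θ⁻¹)
    linarith
  · have := mul_le_mul_of_nonneg_right
      (abs_sub_rpow_le_flux_add hp hθ hε (hf.nonneg z.1) (hf.nonneg z.2))
      (G.weight_nonneg z.1 z.2)
    rw [hfabs, hfabs]
    linarith

/-! ### The estimates at a fixed time -/

/-- The constant in the `ℓ^∞` bound. -/
noncomputable def supConst (p N : ℝ) : ℝ :=
  2 * (max 1 (2 * ((2 : ℝ) ^ p) ^ 2 * ((2 : ℝ) ^ p) ^ (p / N)⁻¹ / (p - 2))) ^ (p - 2)⁻¹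

theorem supConst_pos (p N : ℝ) : 0 < supConst p N :=
  mul_pos two_pos (Real.rpow_pos_of_pos (zero_lt_one.trans_le (le_max_left _ _)) _)

theorem IsSubEigen.le_supConst [Infinite V] (hp : 2 < p) (hN : 0 < N) {κ δ H τ M : ℝ}
    (hΛ : FaberKrahnFunction p N κ Λ) (hFK : G.FaberKrahn p Λ) (hδ : 0 < δ)
    (hdeg : ∀ x, δ ≤ G.deg x) (hτ : 0 < τ) (hH : 0 < H) {f : V → ℝ}
    (hf : G.IsSubEigen p (1 / ((p - 2) * τ)) H f) {x₀ : V} (hx₀ : f x₀ = H)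
    (hM : ∑' x, f x * G.deg x = M) (hM0 : 0 < M) :
    H ≤ supConst p N * M * psiInv p 1 Λ (τ⁻¹ * M ^ (-(p - 2))) := by
  have hp2 : 0 < p - 2 := by linarith
  have h1 := hf.max_estimate hp hN hΛ hFK hδ hdeg (by positivity) hH hx₀
  rw [hM] at h1
  rw [supConst]
  set C := 2 * ((2 : ℝ) ^ p) ^ 2 * ((2 : ℝ) ^ p) ^ (p / N)⁻¹ with hC
  have hM2 : 0 < M ^ (-(p - 2)) := Real.rpow_pos_of_pos hM0 _
  obtain ⟨hs, hψ⟩ := psiInv_spec hp hN hΛ (by positivity : 0 < τ⁻¹ * M ^ (-(p - 2)))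
  set s := psiInv p 1 Λ (τ⁻¹ * M ^ (-(p - 2)))
  have h2 : psi p 1 Λ (H / (2 * M)) ≤ max 1 (C / (p - 2)) * psi p 1 Λ s := by
    rw [hψ, psi, div_one, inv_div, Real.div_rpow hH.le (by positivity)]
    have h3 : (2 * M) ^ (-(p - 2)) ≤ M ^ (-(p - 2)) :=
      Real.rpow_le_rpow_of_nonpos hM0 (by linarith) (by linarith)
    have h4 : 0 < (2 * M) ^ (-(p - 2)) := Real.rpow_pos_of_pos (by positivity) _
    calc H ^ (p - 2) / (2 * M) ^ (p - 2) * Λ (2 * M / H)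
        = (2 * M) ^ (-(p - 2)) * (H ^ (p - 2) * Λ (2 * M / H)) := by
          rw [Real.rpow_neg (by positivity)]; ring
      _ ≤ (2 * M) ^ (-(p - 2)) * (C * (1 / ((p - 2) * τ))) := mul_le_mul_of_nonneg_left h1 h4.le
      _ = C / (p - 2) * (τ⁻¹ * (2 * M) ^ (-(p - 2))) := by field_simp
      _ ≤ max 1 (C / (p - 2)) * (τ⁻¹ * M ^ (-(p - 2))) :=
        mul_le_mul (le_max_right _ _) (mul_le_mul_of_nonneg_left h3 (by positivity))
          (by positivity) (by positivity)
  have h3 := le_of_psi_le hp hΛ (by positivity) hs (le_max_left _ _) h2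
  rw [div_le_iff₀ (by positivity)] at h3
  linarith

/-- The constant in the fixed-time gradient bound. -/
noncomputable def gradConst (p N : ℝ) : ℝ :=
  2 * (((p - 2) / (p - 1))⁻¹ / (p - 2) * supConst p N ^ ((p - 2) / (p - 1)) + 1)

theorem gradConst_pos {p : ℝ} (hp : 2 < p) (N : ℝ) : 0 < gradConst p N := by
  have h1 : 0 < p - 2 := by linarith
  have h2 : 0 < p - 1 := by linarith
  have h3 := Real.rpow_pos_of_pos (supConst_pos p N) ((p - 2) / (p - 1))
  rw [gradConst]
  positivity

theorem IsSubEigen.gradient_estimate [Infinite V] (hp : 2 < p) {H τ M s : ℝ}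
    (hτ : 0 < τ) {f : V → ℝ}
    (hf : G.IsSubEigen p (1 / ((p - 2) * τ)) H f)
    (hM : ∑' x, f x * G.deg x = M) (hM0 : 0 < M) (hs : 0 < s) (hH0 : 0 ≤ H)
    (hH : H ≤ supConst p N * M * s) :
    ∑' x, ∑' y, ENNReal.ofReal (|f y - f x| ^ (p - 1) * G.weight x y) ≤
      ENNReal.ofReal (gradConst p N * M ^ (2 * (p - 1) / p) *
        (τ ^ (-((p - 1) / p)) * s ^ ((p - 2) / p))) := by
  have hp0 : 0 < p := by linarith
  have hp1 : 0 < p - 1 := by linarith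
  have hp2 : 0 < p - 2 := by linarith
  set θ : ℝ := (p - 2) / (p - 1) with hθ
  have hθ0 : 0 < θ := div_pos hp2 hp1
  set X : ℝ := M * s with hX
  have hX0 : 0 < X := mul_pos hM0 hs
  -- this `ε` balances the two terms of `abs_sub_rpow_le_flux_add`
  set ε : ℝ := τ ^ (1 / p) * X ^ (-(θ / p)) with hε
  have hε0 : 0 < ε := mul_pos (Real.rpow_pos_of_pos hτ _) (Real.rpow_pos_of_pos hX0 _)
  refine (hf.tsum_abs_sub_rpow_le hp (by positivity) hθ hε0).trans
    (ENNReal.ofReal_le_ofReal ?_)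
  rw [hM]
  set Y : ℝ := τ ^ (-((p - 1) / p)) * X ^ ((p - 2) / p) with hY
  have hY0 : 0 < Y := mul_pos (Real.rpow_pos_of_pos hτ _) (Real.rpow_pos_of_pos hX0 _)
  have h1 : ε ^ (-(p - 1)) = Y := by
    rw [hε, Real.mul_rpow (Real.rpow_nonneg hτ.le _) (Real.rpow_nonneg hX0.le _),
      ← Real.rpow_mul hτ.le, ← Real.rpow_mul hX0.le, hY]
    congr 2
    · ring
    · rw [hθ]; field_simp
  have h2 : ε * (1 / τ) * X ^ θ = Y := by
    have h3 : (1 : ℝ) / τ = τ ^ (-1 : ℝ) := by rw [Real.rpow_neg_one, one_div]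
    rw [h3, hε, hY]
    calc τ ^ (1 / p) * X ^ (-(θ / p)) * τ ^ (-1 : ℝ) * X ^ θ
        = τ ^ (1 / p) * τ ^ (-1 : ℝ) * (X ^ (-(θ / p)) * X ^ θ) := by ring
      _ = τ ^ (1 / p + -1) * X ^ (-(θ / p) + θ) := by
        rw [Real.rpow_add hτ, Real.rpow_add hX0]
      _ = _ := by
        congr 2
        · field_simp; ring
        · rw [hθ]; field_simp; ring
  have h4 : M ^ (2 * (p - 1) / p) * (τ ^ (-((p - 1) / p)) * s ^ ((p - 2) / p)) = M * Y := by
    rw [hY, hX, Real.mul_rpow hM0.le hs.le,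
      show 2 * (p - 1) / p = 1 + (p - 2) / p by field_simp; ring, Real.rpow_add hM0, Real.rpow_one]
    ring
  have h5 : ε * θ⁻¹ * (1 / ((p - 2) * τ)) * H ^ θ ≤
      θ⁻¹ / (p - 2) * supConst p N ^ θ * Y := by
    have h6 : H ^ θ ≤ supConst p N ^ θ * X ^ θ := by
      rw [← Real.mul_rpow (supConst_pos p N).le hX0.le]
      exact Real.rpow_le_rpow hH0 (hH.trans (by rw [hX, mul_assoc])) hθ0.le
    refine (mul_le_mul_of_nonneg_left h6 (by positivity)).trans (le_of_eq ?_)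
    rw [← h2]
    field_simp
  rw [mul_assoc (gradConst p N), h4, h1, gradConst]
  calc 2 * (ε * θ⁻¹ * (1 / ((p - 2) * τ)) * H ^ θ + Y) * M
      ≤ 2 * (θ⁻¹ / (p - 2) * supConst p N ^ θ * Y + Y) * M := by gcongr
    _ = _ := by ring

/-! ### The `ℓ¹` norm along the flow -/

theorem lNorm_one_eq {f : V → ℝ} (hf : ∀ x, 0 ≤ f x) (hs : Summable fun x => f x * G.deg x) :
    G.lNorm 1 f = ENNReal.ofReal (∑' x, f x * G.deg x) := by
  rw [ENNReal.ofReal_tsum_of_nonneg (fun x => mul_nonneg (hf x) (G.deg_nonneg x)) hs, lNorm]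
  simp only [Real.rpow_one, one_div, inv_one, ENNReal.rpow_one]
  exact tsum_congr fun x => by rw [abs_of_nonneg (hf x)]

theorem summable_of_lNorm_one_lt_top {f : V → ℝ} (hf : ∀ x, 0 ≤ f x) (h : G.lNorm 1 f < ∞) :
    Summable fun x => f x * G.deg x := by
  rw [lNorm] at h
  simp only [Real.rpow_one, one_div, inv_one, ENNReal.rpow_one] at h
  refine (ENNReal.summable_toReal h.ne).congr fun x => ?_
  rw [abs_of_nonneg (hf x), ENNReal.toReal_ofReal (mul_nonneg (hf x) (G.deg_nonneg x))]

theorem IsGlobalFlow.lNorm_eq {R : ℝ} {u₀ : V → ℝ} {u : V → ℝ → ℝ}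
    (hu : G.IsGlobalFlow p R u₀ u) {t : ℝ} (ht : 0 ≤ t) :
    G.lNorm 1 (fun x => u x t) = ENNReal.ofReal (∑' x, u₀ x * G.deg x) := by
  rw [lNorm_one_eq (fun x => hu.nonneg x t ht) (hu.summable t ht), hu.mass t ht]

theorem IsGlobalFlow.isCauchySolution {R : ℝ} {u₀ : V → ℝ} {u : V → ℝ → ℝ}
    (hu : G.IsGlobalFlow p R u₀ u) {T : ℝ} (hT : 0 < T) : G.IsCauchySolution p 1 T u₀ u where
  bounded := by
    refine ⟨Real.toNNReal (∑' x, u₀ x * G.deg x), ?_⟩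
    filter_upwards [ae_restrict_mem measurableSet_Ioo] with t ht
    rw [hu.lNorm_eq ht.1.le]
    rfl
  contDiff x := hu.contDiff x T hT
  equation x t ht := hu.equation x t ht.1
  initial := hu.initial

end WeightedGraph

/-! ### Integration in time -/

theorem lintegral_Ioo_rpow {c a t : ℝ} (hc : 0 ≤ c) (ha : -1 < a) (ht : 0 < t) :
    ∫⁻ τ in Ioo 0 t, ENNReal.ofReal (c * τ ^ a) = ENNReal.ofReal (c * (t ^ (a + 1) / (a + 1))) := by
  have hint : IntegrableOn (fun τ : ℝ => c * τ ^ a) (Ioo 0 t) :=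
    (((intervalIntegrable_iff_integrableOn_Ioo_of_le ht.le).1
      (intervalIntegral.intervalIntegrable_rpow' ha))).const_mul c
  rw [← ofReal_integral_eq_lintegral_ofReal hint]
  · rw [← integral_Ioc_eq_integral_Ioo, ← intervalIntegral.integral_of_le ht.le,
      intervalIntegral.integral_const_mul, integral_rpow (Or.inl ha),
      Real.zero_rpow (by linarith), sub_zero]
  · filter_upwards [ae_restrict_mem measurableSet_Ioo] with τ hτ
    exact mul_nonneg hc (Real.rpow_nonneg hτ.1.le _)

/-- Going back from time `t` to time `τ < t` costs at most a power of `t / τ`. -/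
theorem psiInv_le_mul_psiInv {p N κ M τ t : ℝ} {Λ : ℝ → ℝ} (hp : 2 < p) (hN : 0 < N)
    (hΛ : FaberKrahnFunction p N κ Λ) (hM : 0 < M) (hτ : 0 < τ) (hτt : τ ≤ t) :
    psiInv p 1 Λ (τ⁻¹ * M ^ (-(p - 2))) ≤
      (t / τ) ^ (p - 2 + p / N)⁻¹ * psiInv p 1 Λ (t⁻¹ * M ^ (-(p - 2))) := by
  have ht : 0 < t := hτ.trans_le hτt
  have hM2 : 0 < M ^ (-(p - 2)) := Real.rpow_pos_of_pos hM _
  obtain ⟨h1, h2⟩ := psiInv_spec hp hN hΛ (by positivity : 0 < τ⁻¹ * M ^ (-(p - 2)))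
  obtain ⟨h3, h4⟩ := psiInv_spec hp hN hΛ (by positivity : 0 < t⁻¹ * M ^ (-(p - 2)))
  refine le_of_psi_le_of_lower_growth hp hN hΛ h1 h3 ((one_le_div hτ).2 hτt) ?_
  rw [h2, h4]
  refine le_of_eq ?_
  field_simp

theorem exponent_gap {p N : ℝ} (hp : 2 < p) (hN : 0 < N) :
    (p - 2 + p / N)⁻¹ * ((p - 2) / p) < 1 / p := by
  have hp0 : 0 < p := by linarith
  have hpN : 0 < p / N := div_pos hp0 hN
  rw [← mul_div_assoc]
  refine div_lt_div_of_pos_right ?_ hp0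
  rw [inv_mul_lt_iff₀ (by linarith)]
  linarith

theorem theorem1p4 (p N : ℝ) (hp : 2 < p) (hN : 0 < N) :
    ∃ γ : ℝ, 0 < γ ∧
      ∀ (V : Type*) [Infinite V] (G : WeightedGraph V) (Λ : ℝ → ℝ) (ω : ℝ), 0 < ω →
        FaberKrahnFunction p N ω Λ → G.FaberKrahn p Λ →
        ∀ u₀ : V → ℝ, (∀ x, 0 ≤ u₀ x) → G.lNorm 1 u₀ < ∞ →
          ∃ u : V → ℝ → ℝ,
            (∀ T : ℝ, 0 < T → G.IsCauchySolution p 1 T u₀ u) ∧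
            (∀ x, ∀ t : ℝ, 0 ≤ t → 0 ≤ u x t) ∧
            (∀ r T : ℝ, 1 ≤ r → 0 < T → ∀ v : V → ℝ → ℝ, G.IsCauchySolution p r T u₀ v →
              ∀ x, ∀ t ∈ Set.Icc 0 T, v x t = u x t) ∧
            ∀ t : ℝ, 0 < t →
              G.lNorm 1 (fun x => u x t) = G.lNorm 1 u₀ ∧
              lInfNorm (fun x => u x t) ≤
                ENNReal.ofReal (γ * (G.lNorm 1 u₀).toReal *
                  psiInv p 1 Λ (t⁻¹ * (G.lNorm 1 u₀).toReal ^ (-(p - 2)))) ∧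
              (∫⁻ τ in Set.Ioo 0 t,
                  ∑' x, ∑' y, ENNReal.ofReal (|u y τ - u x τ| ^ (p - 1) * G.weight x y)) ≤
                ENNReal.ofReal (γ * t ^ (1 / p) *
                  (G.lNorm 1 u₀).toReal ^ (2 * (p - 1) / p) *
                  psiInv p 1 Λ (t⁻¹ * (G.lNorm 1 u₀).toReal ^ (-(p - 2))) ^ ((p - 2) / p)) := by
  have hp0 : 0 < p := by linarith
  have hp1 : 0 < p - 1 := by linarith
  have hp2 : 0 < p - 2 := by linarith
  set η : ℝ := (p - 2 + p / N)⁻¹ * ((p - 2) / p) with hη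
  have hgap : 0 < 1 / p - η := sub_pos.2 (exponent_gap hp hN)
  set γ₂ : ℝ := WeightedGraph.gradConst p N / (1 / p - η) with hγ₂
  have hγ₂0 : 0 < γ₂ := div_pos (WeightedGraph.gradConst_pos hp N) hgap
  refine ⟨max (WeightedGraph.supConst p N) γ₂, lt_max_of_lt_right hγ₂0, ?_⟩
  intro V _ G Λ κ _ hΛ hFK u₀ hu₀ hfin
  have hs := WeightedGraph.summable_of_lNorm_one_lt_top hu₀ hfin
  obtain ⟨δ, hδ, hdeg⟩ := hFK.exists_le_deg hp hN hΛ
  rw [WeightedGraph.lNorm_one_eq hu₀ hs]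
  set M : ℝ := ∑' x, u₀ x * G.deg x with hMdef
  have hM0 : 0 ≤ M := tsum_nonneg fun x => mul_nonneg (hu₀ x) (G.deg_nonneg x)
  rw [ENNReal.toReal_ofReal hM0]
  have hbound : ∀ x, u₀ x ≤ M / δ := fun x => by
    rw [le_div_iff₀ hδ]
    exact (mul_le_mul_of_nonneg_left (hdeg x) (hu₀ x)).trans
      (hs.le_tsum x fun y _ => mul_nonneg (hu₀ y) (G.deg_nonneg y))
  obtain ⟨u, hu⟩ := G.exists_isGlobalFlow hp hδ hdeg hu₀ hbound hs
  refine ⟨u, fun T hT => hu.isCauchySolution hT, hu.nonneg,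
    fun r T hr hT v hv => hu.unique hp hr hT hδ hdeg hv, fun t ht => ⟨hu.lNorm_eq ht.le, ?_⟩⟩
  rcases hM0.eq_or_lt with hM | hM
  · -- zero mass forces `u = 0`
    have hz : ∀ τ, 0 ≤ τ → ∀ x, u x τ = 0 := fun τ hτ x => by
      have h1 := (hu.summable τ hτ).le_tsum x fun y _ =>
        mul_nonneg (hu.nonneg y τ hτ) (G.deg_nonneg y)
      rw [hu.mass τ hτ, ← hMdef, ← hM] at h1
      have h2 := G.deg_pos x
      nlinarith [hu.nonneg x τ hτ]
    constructor
    · refine iSup_le fun x => ?_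
      simp [hz t ht.le x]
    · refine le_trans (le_of_eq ?_) zero_le
      rw [setLIntegral_congr_fun (g := fun _ => 0) measurableSet_Ioo fun τ hτ => ?_]
      · simp
      · simp [hz τ hτ.1.le, Real.zero_rpow hp1.ne']
  -- at each time a maximum is attained, and the elliptic estimates apply
  have hsup : ∀ τ, 0 < τ → ∃ H, 0 ≤ H ∧ G.IsSubEigen p (1 / ((p - 2) * τ)) H (fun x => u x τ) ∧
      H ≤ WeightedGraph.supConst p N * M * psiInv p 1 Λ (τ⁻¹ * M ^ (-(p - 2))) := by
    intro τ hτ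
    obtain ⟨o, ho⟩ : ∃ o, 0 < u o τ := by
      by_contra! hcon
      have h1 : ∑' x, u x τ * G.deg x = 0 := by
        rw [← tsum_zero]
        exact tsum_congr fun x => by
          rw [le_antisymm (hcon x) (hu.nonneg x τ hτ.le), zero_mul]
      rw [hu.mass τ hτ.le] at h1
      exact hM.ne' h1
    obtain ⟨x₀, hx₀⟩ := WeightedGraph.exists_max hδ hdeg (fun x => hu.nonneg x τ hτ.le)
      (hu.summable τ hτ.le) ho
    have hsub : G.IsSubEigen p (1 / ((p - 2) * τ)) (u x₀ τ) (fun x => u x τ) :=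
      ⟨fun x => hu.nonneg x τ hτ.le, hx₀, hu.summable τ hτ.le, fun x => by
        rw [one_div_mul_eq_div]; exact hu.neg_pLaplacian_le hp x hτ⟩
    exact ⟨u x₀ τ, hu.nonneg x₀ τ hτ.le, hsub, hsub.le_supConst hp hN hΛ hFK hδ hdeg hτ
      (ho.trans_le (hx₀ o)) rfl (hu.mass τ hτ.le) hM⟩
  have hM2 : 0 < M ^ (-(p - 2)) := Real.rpow_pos_of_pos hM _
  have hspos : ∀ τ, 0 < τ → 0 < psiInv p 1 Λ (τ⁻¹ * M ^ (-(p - 2))) := fun τ hτ =>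
    (psiInv_spec hp hN hΛ (by positivity)).1
  set s : ℝ := psiInv p 1 Λ (t⁻¹ * M ^ (-(p - 2)))
  have hs0 : 0 < s := hspos t ht
  have hs' : 0 < s ^ ((p - 2) / p) := Real.rpow_pos_of_pos hs0 _
  have hMp : 0 < M ^ (2 * (p - 1) / p) := Real.rpow_pos_of_pos hM _
  constructor
  · obtain ⟨H, -, hsub, hH⟩ := hsup t ht
    refine iSup_le fun x => ENNReal.ofReal_le_ofReal ?_
    rw [abs_of_nonneg (hu.nonneg x t ht.le)]
    refine (hsub.le_bound x).trans (hH.trans ?_)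
    gcongr
    exact le_max_left _ _
  · set K : ℝ := WeightedGraph.gradConst p N * M ^ (2 * (p - 1) / p) * (s ^ ((p - 2) / p) * t ^ η) with hK
    have hK0 : 0 ≤ K := by
      have := WeightedGraph.gradConst_pos hp N
      have := Real.rpow_pos_of_pos ht η
      positivity
    have hpt : ∀ τ ∈ Ioo 0 t,
        ∑' x, ∑' y, ENNReal.ofReal (|u y τ - u x τ| ^ (p - 1) * G.weight x y) ≤
          ENNReal.ofReal (K * τ ^ (-((p - 1) / p) - η)) := by
      intro τ hτ
      obtain ⟨H, hH0, hsub, hH⟩ := hsup τ hτ.1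
      refine (hsub.gradient_estimate hp hτ.1 (hu.mass τ hτ.1.le) hM (hspos τ hτ.1) hH0 hH).trans
        (ENNReal.ofReal_le_ofReal ?_)
      have h1 : psiInv p 1 Λ (τ⁻¹ * M ^ (-(p - 2))) ^ ((p - 2) / p) ≤
          t ^ η * τ ^ (-η) * s ^ ((p - 2) / p) := by
        refine (Real.rpow_le_rpow (hspos τ hτ.1).le
          (psiInv_le_mul_psiInv hp hN hΛ hM hτ.1 hτ.2.le) (by positivity)).trans (le_of_eq ?_)
        rw [Real.mul_rpow (Real.rpow_nonneg (div_pos ht hτ.1).le _) hs0.le,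
          ← Real.rpow_mul (div_pos ht hτ.1).le, ← hη, Real.div_rpow ht.le hτ.1.le,
          Real.rpow_neg hτ.1.le, div_eq_mul_inv]
      have h2 := WeightedGraph.gradConst_pos hp N
      have h3 : 0 < τ ^ (-((p - 1) / p)) := Real.rpow_pos_of_pos hτ.1 _
      calc _ ≤ WeightedGraph.gradConst p N * M ^ (2 * (p - 1) / p) *
            (τ ^ (-((p - 1) / p)) * (t ^ η * τ ^ (-η) * s ^ ((p - 2) / p))) := by gcongr
        _ = _ := by
          rw [sub_eq_add_neg (-((p - 1) / p)), Real.rpow_add hτ.1, hK]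
          ring
    refine (setLIntegral_mono' measurableSet_Ioo hpt).trans ?_
    have ha1 : -((p - 1) / p) - η + 1 = 1 / p - η := by field_simp; ring
    rw [lintegral_Ioo_rpow hK0 (by linarith) ht, ha1]
    refine ENNReal.ofReal_le_ofReal ?_
    have h5 : K * (t ^ (1 / p - η) / (1 / p - η)) =
        γ₂ * t ^ (1 / p) * M ^ (2 * (p - 1) / p) * s ^ ((p - 2) / p) := by
      have h6 : t ^ (1 / p) = t ^ η * t ^ (1 / p - η) := by
        rw [← Real.rpow_add ht]; congr 1; ring
      rw [hK, hγ₂, h6]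
      ring
    rw [h5]
    gcongr
    exact le_max_right _ _
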